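/- Let $s\ge 1$ and $0\le K< M$ be integers, $N=M-K$, let $p_1,\dots,p_s\ge 0$ be prices, $\lambda_j=\sum_{k=j}^s p_k$, and let $\Phi$ be a real number (the budget). An \emph{allocation} is a sequence of nonnegative integers $C_1,\dots,C_s$ with $$C_1\le C_2\le\dots\le C_s,\quad C_1\ge K,\quad C_s\le M,\quad C_s-C_1=M-K,\qquad C_1\sum_{i=1}^s p_i\le\sum_{i=1}^s C_ip_i\le\Phi\le C_s\sum_{i=1}^s p_i .$$ All allocations are regarded as equiprobable. Let the real numbers $\beta,\sigma$ satisfy $\beta\lambda_j>\sigma$ $(2\le j\le s)$ and $$\sum_{j=2}^s\frac1{e^{\beta\lambda_j-\sigma}-1}=M-K,\qquad \sum_{i=2}^s p_i\sum_{j=2}^i\frac1{e^{\beta\lambda_j-\sigma}-1}=\Phi-K\sum_{i=1}^s p_i. \tag{$*$}$$ (a) If $s\ge2$ and $N\lambda_s<\Phi-K\sum_{i=1}^s p_i\le \frac{N}{s-1}\sum_{j=2}^s\lambda_j$, then there is exactly one pair $(\beta,\sigma)$ with these properties, and it has $\beta\ge0$. (b) Let $a_1,\delta>0$ and $a_2,B,\beta_0,R$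 be real constants. There is a constant $A>0$, depending only on $a_1,a_2,B,\beta_0,R,\delta$, such that for every $m\in\mathbb N$ and every $c>0$ there is $N_0$ such that the following holds for all data as above with $N\ge N_0$, $a_1N\le s\le a_2N$, $\lambda_i\le B$ $(1\le i\le s)$, $(*)$ and $0\le\beta\le\beta_0$, provided that either $e^{\beta_0B}<1+a_1$, or $\frac1{e^{\beta\lambda_j-\sigma}-1}\le R$ for all $2\le j\le s$. The number of allocations that violate $$\Bigl|\,C_i-C_1-\sum_{j=2}^i\frac1{e^{\beta\sum_{k=j}^sp_k-\sigma}-1}\Bigr|\le A\,N^{3/4}\qquad\text{for all } i \text{ with } \delta N<i\le s$$ is less than $cN^{-m}$ times the number of all allocations. In other words, the allocations $C_i=C_1+\sum_{j=2}^i\frac{1}{e^{\beta\sum_{k\ge j}p_k-\sigma}-1}+O(N^{3/4})$, $i>\delta N$, form the overwhelmingly largest ("risk-free") cluster. -/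

import Mathlib

open Finset

noncomputable section

/-- The tail sum `λ_j = p_j + p_{j+1} + ⋯ + p_s` of the prices. -/
def tailPrice (s : ℕ) (p : ℕ → ℝ) (j : ℕ) : ℝ :=
  ∑ k ∈ Icc j s, p k

/-- The mean increment `1 / (e^{β λ_j - σ} - 1)`. -/
def meanIncrement (s : ℕ) (p : ℕ → ℝ) (β σ : ℝ) (j : ℕ) : ℝ :=
  1 / (Real.exp (β * tailPrice s p j - σ) - 1)

/-- Admissible share allocations `C_1, …, C_s`. A finite sequence is encoded as a function on `ℕ`
that vanishes outside `{1, …, s}`, so that each allocation is counted once. -/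
structure IsAllocation (s K M : ℕ) (p : ℕ → ℝ) (Φ : ℝ) (C : ℕ → ℕ) : Prop where
  support : ∀ i, i ∉ Icc 1 s → C i = 0
  ordered : ∀ i ∈ Ico 1 s, C i ≤ C (i + 1)
  lower : K ≤ C 1
  upper : C s ≤ M
  /-- the increments `C_i - C_{i-1}`, `2 ≤ i ≤ s`, add up to `M - K` -/
  total : (C s : ℤ) - C 1 = M - K
  budget_lower : (C 1 : ℝ) * ∑ i ∈ Icc 1 s, p i ≤ ∑ i ∈ Icc 1 s, (C i : ℝ) * p i
  budget : ∑ i ∈ Icc 1 s, (C i : ℝ) * p i ≤ Φ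
  budget_upper : Φ ≤ (C s : ℝ) * ∑ i ∈ Icc 1 s, p i

/-- The set of all admissible allocations (the equiprobable outcomes). -/
def allocations (s K M : ℕ) (p : ℕ → ℝ) (Φ : ℝ) : Set (ℕ → ℕ) :=
  {C | IsAllocation s K M p Φ C}

/-- The two conditions that determine `β` and `σ`: the mean increments are (finite and) positive,
they add up to `M - K`, and they exhaust the budget. -/
structure IsParameters (s K M : ℕ) (p : ℕ → ℝ) (Φ β σ : ℝ) : Prop where
  pos : ∀ j ∈ Icc 2 s, 0 < β * tailPrice s p j - σ
  total : ∑ j ∈ Icc 2 s, meanIncrement s p β σ j = (M : ℝ) - K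
  budget : ∑ i ∈ Icc 2 s, p i * ∑ j ∈ Icc 2 i, meanIncrement s p β σ j
    = Φ - K * ∑ i ∈ Icc 1 s, p i

/-- The cluster of admissible allocations with
`|C_i - C_1 - ∑_{j=2}^i 1 / (e^{β λ_j - σ} - 1)| ≤ A N^{3/4}` for all `i > δ N`, `N = M - K`. -/
def cluster (s K M : ℕ) (p : ℕ → ℝ) (Φ β σ δ A : ℝ) : Set (ℕ → ℕ) :=
  {C | C ∈ allocations s K M p Φ ∧ ∀ i ∈ Icc 1 s, δ * ((M : ℝ) - K) < i →
    |(C i : ℝ) - ((C 1 : ℝ) + ∑ j ∈ Icc 2 i, meanIncrement s p β σ j)|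
      ≤ A * ((M : ℝ) - K) ^ (3 / 4 : ℝ)}

theorem IsAllocation.le_upper {s K M : ℕ} {p : ℕ → ℝ} {Φ : ℝ} {C : ℕ → ℕ}
    (h : IsAllocation s K M p Φ C) (i : ℕ) : C i ≤ M := by
  by_cases hi : i ∈ Icc 1 s
  · rw [mem_Icc] at hi
    have key : ∀ k, i ≤ k → k ≤ s → C i ≤ C k := by
      intro k hk
      induction k, hk using Nat.le_induction with
      | base => exact fun _ => le_rfl
      | succ k hk ih =>
        intro hs
        exact (ih (by omega)).trans (h.ordered k (by rw [mem_Ico]; omega))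
    exact (key s hi.2 le_rfl).trans h.upper
  · rw [h.support i hi]; exact Nat.zero_le _

/-- There are finitely many allocations, so counting them with `Set.ncard` is meaningful. -/
theorem allocations_finite (s K M : ℕ) (p : ℕ → ℝ) (Φ : ℝ) : (allocations s K M p Φ).Finite := by
  refine Set.Finite.of_injOn (f := fun (C : ℕ → ℕ) (i : Fin (s + 1)) => C i)
    (t := Set.Iic (fun _ => M)) ?_ ?_ (Set.finite_Iic _)
  · intro C hC i
    exact IsAllocation.le_upper hC i
  · intro C hC D hD h
    funext i
    by_cases hi : i ∈ Icc 1 s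
    · rw [mem_Icc] at hi
      exact congrFun h ⟨i, by omega⟩
    · rw [hC.support i hi, hD.support i hi]

end

/-! An allocation has `C 1 = K` and `C s = M`, so it is the same as its increments n_j, 2 ≤ j ≤ s:
nonnegative integers with Σ n_j = N and Σ λ_j n_j ≤ E, where E = Φ - K Σ p_i. This is a Bose gas
with energy levels λ_j.

Let the n_j be independent geometric variables with ratios e^{-x_j}, x_j = βλ_j - σ. Their means are
the mean increments, and on the shell Σ n_j = N the weight of n depends only on the energy Σ λ_j n_j
(`geomWeight_eq_exp`). As β ≥ 0, every allocation has weight at least the value V of that weight at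
energy E. Hence the number of bad allocations times V is at most the probability of a large
deviation, which Chernoff's bound with parameter N^{-1/4} and a union bound over i make at most 2s
exp(-(A - const) √N) (`ncard_diff_cluster_mul_le`).

For the total number no local limit theorem is needed, since a loss of exp(O(√N)) is absorbed by A.
With probability at least 1/2 the increments have fluctuations of order √N. Empty the L ~ √N most
expensive positions and put the units missing from N at the cheapest position s: the price saved
outweighs the fluctuation, so a genuine allocation results. The change costs a factor exp(O(L)),
because the means lie between two positive constants (`exists_meanIncrement_bounds`). This gives
`half_le_ncard_allocations`.

For (a), put h_j = λ_j - λ_s and w = βλ_s - σ. For each β ≥ 0 one w(β) gives total N; it is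
continuous, and the intermediate value theorem in β yields the budget. Uniqueness, among all real β,
follows from the strict monotonicity of x ↦ 1/(e^x - 1). -/

/-! ### Geometric variables: means and exponential moments -/

/-- The mean of a geometric variable with ratio `e^{-x}`. -/
noncomputable def geomMean (x : ℝ) : ℝ := 1 / (Real.exp x - 1)

theorem geomMean_pos {x : ℝ} (hx : 0 < x) : 0 < geomMean x :=
  one_div_pos.2 (sub_pos.2 (Real.one_lt_exp_iff.2 hx))

theorem one_sub_exp_neg_eq {x : ℝ} (hx : 0 < x) :
    1 - Real.exp (-x) = 1 / (1 + geomMean x) := by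
  have h : 0 < Real.exp x - 1 := sub_pos.2 (Real.one_lt_exp_iff.2 hx)
  have h' := Real.exp_pos x
  rw [geomMean, Real.exp_neg]
  field_simp
  ring

theorem exp_neg_eq_geomMean_div {x : ℝ} (hx : 0 < x) :
    Real.exp (-x) = geomMean x / (1 + geomMean x) := by
  have h := one_sub_exp_neg_eq hx
  have h' := geomMean_pos hx
  have : Real.exp (-x) = 1 - 1 / (1 + geomMean x) := by linarith
  rw [this]
  field_simp
  ring

theorem exp_eq_one_add_one_div_geomMean (x : ℝ) :
    Real.exp x = 1 + 1 / geomMean x := by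
  rw [geomMean]
  simp

/-- Since -log(1 - y) = y + y²/2 + ⋯, replacing y²/2 by y² leaves room for the remainder when |y| ≤
1/2. -/
theorem one_div_one_sub_le_exp {y : ℝ} (hy : |y| ≤ 1 / 2) :
    1 / (1 - y) ≤ Real.exp (y + y ^ 2) := by
  obtain ⟨h1, h2⟩ := abs_le.1 hy
  rw [div_le_iff₀ (by linarith)]
  rcases le_total 0 y with h | h
  · have h3 := Real.quadratic_le_exp_of_nonneg (x := y + y ^ 2) (by positivity)
    -- The right side equals 1 + y² ((1 - y)(1 + y)²/2 - y) exactly.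
    have h4 : 1 ≤ (1 + (y + y ^ 2) + (y + y ^ 2) ^ 2 / 2) * (1 - y) := by
      have h5 : 0 ≤ y ^ 2 * ((1 - y) * (1 + y) ^ 2 / 2 - y) := by
        apply mul_nonneg (sq_nonneg _)
        nlinarith [mul_nonneg h h, mul_nonneg (mul_nonneg h h) (sub_nonneg.2 h2)]
      nlinarith
    exact h4.trans (mul_le_mul_of_nonneg_right h3 (by linarith))
  · have h3 := Real.add_one_le_exp (y + y ^ 2)
    have h4 : 1 ≤ (y + y ^ 2 + 1) * (1 - y) := by
      have : 0 ≤ y ^ 2 * (-y) := mul_nonneg (sq_nonneg _) (by linarith)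
      nlinarith
    exact h4.trans (mul_le_mul_of_nonneg_right h3 (by linarith))

/-- The centred exponential moments of a geometric variable of mean at most `R` are Gaussian near
the origin. -/
theorem sum_geom_exp_le {x R u : ℝ} (hx : 0 < x) (hR : geomMean x ≤ R) (hu : |u| ≤ 1)
    (huR : 4 * R * |u| ≤ 1) (T : ℕ) :
    ∑ k ∈ range T, (1 - Real.exp (-x)) * Real.exp (-x) ^ k * Real.exp (u * (k - geomMean x))
      ≤ Real.exp ((R + 4 * R ^ 2) * u ^ 2) := by
  set μ := geomMean x with hμ
  have hμ0 : 0 < μ := geomMean_pos hx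
  have hq : 1 - Real.exp (-x) = 1 / (1 + μ) := one_sub_exp_neg_eq hx
  have hq' : Real.exp (-x) = μ / (1 + μ) := exp_neg_eq_geomMean_div hx
  have he := abs_le.1 (Real.abs_exp_sub_one_sub_id_le hu)
  have hu2 : u ^ 2 ≤ |u| := by
    rw [← sq_abs]; nlinarith [abs_nonneg u]
  have hea : |Real.exp u - 1| ≤ 2 * |u| := by
    rw [abs_le]
    constructor <;> cases abs_cases u <;> linarith [he.1, he.2]
  -- In this variable the moment generating function of a geometric law of mean μ is 1/(1 - y).
  set y := μ * (Real.exp u - 1) with hy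
  have hya : |y| ≤ 2 * R * |u| := by
    rw [hy, abs_mul, abs_of_pos hμ0]
    calc μ * |Real.exp u - 1| ≤ R * (2 * |u|) :=
          mul_le_mul hR hea (abs_nonneg _) (hμ0.le.trans hR)
      _ = _ := by ring
  have hy2 : |y| ≤ 1 / 2 := by linarith
  have hy1 : y < 1 := by linarith [le_abs_self y]
  have hr : 1 - Real.exp (-x) * Real.exp u = (1 - y) / (1 + μ) := by
    rw [hq', hy]; field_simp; ring
  have hr0 : 0 < 1 - Real.exp (-x) * Real.exp u := by
    rw [hr]; exact div_pos (by linarith) (by linarith)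
  have hgeo : ∑ k ∈ range T, (Real.exp (-x) * Real.exp u) ^ k
      ≤ (1 - Real.exp (-x) * Real.exp u)⁻¹ := by
    have hp : 0 ≤ Real.exp (-x) * Real.exp u := by positivity
    rw [← tsum_geometric_of_lt_one hp (by linarith)]
    exact (summable_geometric_of_lt_one hp (by linarith)).sum_le_tsum _
      (fun i _ => by positivity)
  calc ∑ k ∈ range T, (1 - Real.exp (-x)) * Real.exp (-x) ^ k * Real.exp (u * (k - μ))
      = (1 - Real.exp (-x)) * Real.exp (-(u * μ)) *
          ∑ k ∈ range T, (Real.exp (-x) * Real.exp u) ^ k := by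
        rw [mul_sum]
        refine sum_congr rfl fun k _ => ?_
        have : Real.exp (u * (k - μ)) = Real.exp (-(u * μ)) * Real.exp u ^ k := by
          rw [← Real.exp_nat_mul, ← Real.exp_add]; congr 1; ring
        rw [this, mul_pow]; ring
    _ ≤ (1 - Real.exp (-x)) * Real.exp (-(u * μ)) * (1 - Real.exp (-x) * Real.exp u)⁻¹ := by
        refine mul_le_mul_of_nonneg_left hgeo ?_
        rw [hq]; positivity
    _ = Real.exp (-(u * μ)) * (1 / (1 - y)) := by
        have : 1 - y ≠ 0 := by linarith
        rw [hr, hq]; field_simp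
    _ ≤ Real.exp (-(u * μ)) * Real.exp (y + y ^ 2) :=
        mul_le_mul_of_nonneg_left (one_div_one_sub_le_exp hy2) (Real.exp_pos _).le
    _ = Real.exp (-(u * μ) + (y + y ^ 2)) := (Real.exp_add _ _).symm
    _ ≤ _ := by
        apply Real.exp_le_exp.2
        -- Centring removes the linear term: y - uμ = μ (e^u - 1 - u).
        have h1 : y - u * μ ≤ R * u ^ 2 := by
          have : y - u * μ = μ * (Real.exp u - 1 - u) := by rw [hy]; ring
          rw [this]
          exact mul_le_mul hR he.2 (by linarith [Real.add_one_le_exp u]) (hμ0.le.trans hR)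
        have h2 : y ^ 2 ≤ 4 * R ^ 2 * u ^ 2 := by
          calc y ^ 2 = |y| ^ 2 := (sq_abs y).symm
            _ ≤ (2 * R * |u|) ^ 2 := pow_le_pow_left₀ (abs_nonneg y) hya 2
            _ = 4 * R ^ 2 * u ^ 2 := by rw [mul_pow, sq_abs]; ring
        nlinarith

/-! ### Product geometric weights and Chernoff's bound -/

open Classical in
/-- The functions `ℕ → ℕ` that vanish outside `I` and are less than `T` on `I`. -/
noncomputable def boxFunctions (I : Finset ℕ) (T : ℕ) : Finset (ℕ → ℕ) :=
  (I.pi fun _ => range T).image fun f j => if h : j ∈ I then f j h else 0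

open Classical in
theorem mem_boxFunctions {I : Finset ℕ} {T : ℕ} {n : ℕ → ℕ} :
    n ∈ boxFunctions I T ↔ (∀ j ∉ I, n j = 0) ∧ ∀ j ∈ I, n j < T := by
  simp only [boxFunctions, mem_image, mem_pi, mem_range]
  constructor
  · rintro ⟨f, hf, rfl⟩
    refine ⟨fun j hj => by simp [hj], fun j hj => by simpa [hj] using hf j hj⟩
  · rintro ⟨h1, h2⟩
    refine ⟨fun j _ => n j, h2, ?_⟩
    funext j
    by_cases hj : j ∈ I
    · simp [hj]
    · simp [hj, h1 j hj]

open Classical in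
theorem sum_boxFunctions (I : Finset ℕ) (T : ℕ) (F : ℕ → ℕ → ℝ) :
    ∑ n ∈ boxFunctions I T, ∏ j ∈ I, F j (n j) = ∏ j ∈ I, ∑ k ∈ range T, F j k := by
  rw [boxFunctions, sum_image, prod_sum]
  · refine sum_congr rfl fun f _ => ?_
    rw [← prod_attach]
    exact prod_congr rfl fun j _ => by simp
  · intro f _ g _ h
    funext j hj
    simpa [hj] using congrFun h j

/-- The probability of `n` under independent geometric laws with ratios `e^{-x_j}`, `j ∈ I`. -/
noncomputable def geomWeight (I : Finset ℕ) (x : ℕ → ℝ) (n : ℕ → ℕ) : ℝ :=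
  ∏ j ∈ I, (1 - Real.exp (-x j)) * Real.exp (-x j) ^ n j

theorem geomWeight_nonneg {I : Finset ℕ} {x : ℕ → ℝ} (hx : ∀ j ∈ I, 0 < x j) (n : ℕ → ℕ) :
    0 ≤ geomWeight I x n := by
  refine prod_nonneg fun j hj => mul_nonneg ?_ (by positivity)
  rw [one_sub_exp_neg_eq (hx j hj)]
  have := geomMean_pos (hx j hj)
  positivity

/-- The box has mass ∏ (1 - e^{-x_j T}), which tends to 1. Large boxes stand in for the whole
probability space, so that only finite sums occur. -/
theorem exists_boxFunctions_mass {I : Finset ℕ} {x : ℕ → ℝ} (hx : ∀ j ∈ I, 0 < x j) {θ : ℝ}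
    (hθ : θ < 1) : ∃ T, θ ≤ ∑ n ∈ boxFunctions I T, geomWeight I x n := by
  have h : Filter.Tendsto (fun T : ℕ => ∏ j ∈ I, (1 - Real.exp (-x j) ^ T)) Filter.atTop
      (nhds (∏ j ∈ I, (1 - 0))) := by
    refine tendsto_finsetProd _ fun j hj => tendsto_const_nhds.sub ?_
    exact tendsto_pow_atTop_nhds_zero_of_lt_one (Real.exp_pos _).le
      (Real.exp_lt_one_iff.2 (by linarith [hx j hj]))
  simp only [sub_zero, prod_const_one] at h
  obtain ⟨T, hT⟩ := (h.eventually (lt_mem_nhds hθ)).exists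
  refine ⟨T, hT.le.trans_eq ?_⟩
  unfold geomWeight
  rw [sum_boxFunctions I T fun j k => (1 - Real.exp (-x j)) * Real.exp (-x j) ^ k]
  refine prod_congr rfl fun j hj => ?_
  rw [← mul_sum, mul_neg_geom_sum]

/-- Chernoff's bound for weighted sums of independent geometric variables of bounded means. -/
theorem geomWeight_chernoff {I : Finset ℕ} {x g : ℕ → ℝ} {R u t : ℝ} (hx : ∀ j ∈ I, 0 < x j)
    (hR0 : 0 ≤ R) (hR : ∀ j ∈ I, geomMean (x j) ≤ R) (hg : ∀ j ∈ I, |g j| ≤ 1) (hu0 : 0 ≤ u)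
    (hu : u ≤ 1) (huR : 4 * R * u ≤ 1) {𝓢 : Finset (ℕ → ℕ)} (hS : ∀ n ∈ 𝓢, ∀ j ∉ I, n j = 0)
    (ht : ∀ n ∈ 𝓢, t ≤ ∑ j ∈ I, g j * (n j - geomMean (x j))) :
    ∑ n ∈ 𝓢, geomWeight I x n ≤ Real.exp (-(u * t) + (R + 4 * R ^ 2) * u ^ 2 * #I) := by
  -- A box containing 𝓢; over it the exponential moment factorizes.
  set T := (𝓢.sup fun n => I.sup n) + 1
  have hsub : 𝓢 ⊆ boxFunctions I T := fun n hn => by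
    refine mem_boxFunctions.2 ⟨hS n hn, fun j hj => Nat.lt_succ_of_le ?_⟩
    exact (le_sup (f := n) hj).trans (le_sup (f := fun n => I.sup n) hn)
  have hterm : ∀ n, geomWeight I x n * Real.exp (u * ∑ j ∈ I, g j * (n j - geomMean (x j)))
      = ∏ j ∈ I, (1 - Real.exp (-x j)) * Real.exp (-x j) ^ n j *
          Real.exp (u * g j * (n j - geomMean (x j))) := by
    intro n
    rw [mul_sum, Real.exp_sum, geomWeight, ← prod_mul_distrib]
    exact prod_congr rfl fun j _ => by rw [mul_assoc u]
  calc ∑ n ∈ 𝓢, geomWeight I x n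
      ≤ ∑ n ∈ 𝓢, Real.exp (-(u * t)) *
          (geomWeight I x n * Real.exp (u * ∑ j ∈ I, g j * (n j - geomMean (x j)))) := by
        refine sum_le_sum fun n hn => ?_
        have h1 : 1 ≤ Real.exp (-(u * t)) *
            Real.exp (u * ∑ j ∈ I, g j * (n j - geomMean (x j))) := by
          rw [← Real.exp_add]
          apply Real.one_le_exp
          nlinarith [mul_le_mul_of_nonneg_left (ht n hn) hu0]
        nlinarith [mul_le_mul_of_nonneg_left h1 (geomWeight_nonneg hx n)]
    _ ≤ ∑ n ∈ boxFunctions I T, Real.exp (-(u * t)) *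
          (geomWeight I x n * Real.exp (u * ∑ j ∈ I, g j * (n j - geomMean (x j)))) :=
        sum_le_sum_of_subset_of_nonneg hsub fun n _ _ =>
          mul_nonneg (Real.exp_pos _).le
            (mul_nonneg (geomWeight_nonneg hx n) (Real.exp_pos _).le)
    _ = Real.exp (-(u * t)) * ∏ j ∈ I, ∑ k ∈ range T, (1 - Real.exp (-x j)) *
          Real.exp (-x j) ^ k * Real.exp (u * g j * (k - geomMean (x j))) := by
        rw [← mul_sum, ← sum_boxFunctions I T fun j k => (1 - Real.exp (-x j)) *
          Real.exp (-x j) ^ k * Real.exp (u * g j * (k - geomMean (x j)))]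
        simp only [hterm]
    _ ≤ Real.exp (-(u * t)) * ∏ j ∈ I, Real.exp ((R + 4 * R ^ 2) * u ^ 2) := by
        refine mul_le_mul_of_nonneg_left (prod_le_prod (fun j hj => ?_) fun j hj => ?_)
          (Real.exp_pos _).le
        · refine sum_nonneg fun k _ => ?_
          rw [one_sub_exp_neg_eq (hx j hj)]
          have := geomMean_pos (hx j hj)
          positivity
        · have hug : |u * g j| ≤ u := by
            rw [abs_mul, abs_of_nonneg hu0]
            exact mul_le_of_le_one_right hu0 (hg j hj)
          refine (sum_geom_exp_le (hx j hj) (hR j hj) (hug.trans hu)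
            ((mul_le_mul_of_nonneg_left hug (by positivity)).trans huR) T).trans ?_
          apply Real.exp_le_exp.2
          refine mul_le_mul_of_nonneg_left ?_ (by positivity)
          rw [← sq_abs]
          exact pow_le_pow_left₀ (abs_nonneg _) hug 2
    _ = _ := by
        rw [prod_const, ← Real.exp_nat_mul, ← Real.exp_add]
        congr 1; ring

theorem geomWeight_chernoff_abs {I : Finset ℕ} {x g : ℕ → ℝ} {R u t : ℝ} (hx : ∀ j ∈ I, 0 < x j)
    (hR0 : 0 ≤ R) (hR : ∀ j ∈ I, geomMean (x j) ≤ R) (hg : ∀ j ∈ I, |g j| ≤ 1) (hu0 : 0 ≤ u)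
    (hu : u ≤ 1) (huR : 4 * R * u ≤ 1) {𝓢 : Finset (ℕ → ℕ)} (hS : ∀ n ∈ 𝓢, ∀ j ∉ I, n j = 0)
    (ht : ∀ n ∈ 𝓢, t ≤ |∑ j ∈ I, g j * (n j - geomMean (x j))|) :
    ∑ n ∈ 𝓢, geomWeight I x n ≤ 2 * Real.exp (-(u * t) + (R + 4 * R ^ 2) * u ^ 2 * #I) := by
  classical
  rw [← sum_filter_add_sum_filter_not 𝓢 fun n => t ≤ ∑ j ∈ I, g j * (n j - geomMean (x j)),
    two_mul]
  refine add_le_add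
    (geomWeight_chernoff hx hR0 hR hg hu0 hu huR (fun n hn => hS n (mem_filter.1 hn).1)
      fun n hn => (mem_filter.1 hn).2)
    (geomWeight_chernoff (g := fun j => -g j) hx hR0 hR (fun j hj => by rw [abs_neg]; exact hg j hj)
      hu0 hu huR (fun n hn => hS n (mem_filter.1 hn).1) fun n hn => ?_)
  obtain ⟨h1, h2⟩ := mem_filter.1 hn
  simp only [neg_mul, sum_neg_distrib]
  exact (le_abs.1 (ht n h1)).resolve_left h2

/-! ### Allocations as increments with energy levels λ_j -/

theorem sum_mul_sum_Icc_eq (s : ℕ) (p a : ℕ → ℝ) :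
    ∑ i ∈ Icc 1 s, p i * ∑ j ∈ Icc 2 i, a j = ∑ j ∈ Icc 2 s, tailPrice s p j * a j := by
  simp only [tailPrice, mul_sum, sum_mul]
  refine sum_comm' fun i j => ?_
  simp only [mem_Icc]
  omega

theorem sum_Icc_two_mul_sum_eq (s : ℕ) (p a : ℕ → ℝ) :
    ∑ i ∈ Icc 2 s, p i * ∑ j ∈ Icc 2 i, a j = ∑ j ∈ Icc 2 s, tailPrice s p j * a j := by
  simp only [tailPrice, mul_sum, sum_mul]
  refine sum_comm' fun i j => ?_
  simp only [mem_Icc]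
  omega

theorem tailPrice_nonneg {s : ℕ} {p : ℕ → ℝ} (hp : ∀ i ∈ Icc 1 s, 0 ≤ p i) {j : ℕ} (hj : 1 ≤ j) :
    0 ≤ tailPrice s p j :=
  sum_nonneg fun k hk => hp k (by rw [mem_Icc] at hk ⊢; omega)

theorem tailPrice_le {s : ℕ} {p : ℕ → ℝ} (hp : ∀ i ∈ Icc 1 s, 0 ≤ p i) {i j : ℕ} (hi : 1 ≤ i)
    (hij : i ≤ j) : tailPrice s p j ≤ tailPrice s p i := by
  refine sum_le_sum_of_subset_of_nonneg (Icc_subset_Icc_left hij) fun k hk _ => hp k ?_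
  rw [mem_Icc] at hk ⊢; omega

/-- The increments `C_j - C_{j-1}`, `2 ≤ j ≤ s`. -/
def increments (s : ℕ) (C : ℕ → ℕ) (j : ℕ) : ℕ :=
  if j ∈ Icc 2 s then C j - C (j - 1) else 0

/-- The sequence `C_1, …, C_s` with `C_1 = K` and the given increments. -/
def accumulate (s K : ℕ) (n : ℕ → ℕ) (i : ℕ) : ℕ :=
  if i ∈ Icc 1 s then K + ∑ j ∈ Icc 2 i, n j else 0

theorem accumulate_of_mem {s K : ℕ} {n : ℕ → ℕ} {i : ℕ} (hi : i ∈ Icc 1 s) :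
    accumulate s K n i = K + ∑ j ∈ Icc 2 i, n j := if_pos hi

section Allocation

variable {s K M : ℕ} {p : ℕ → ℝ} {Φ : ℝ} {C : ℕ → ℕ}

/-- The increments already use up all of M - K, so no room is left between K and `C 1`. -/
theorem IsAllocation.first_eq (h : IsAllocation s K M p Φ C) : C 1 = K := by
  have h1 := h.lower
  have h2 := h.upper
  have h3 := h.total
  omega

theorem IsAllocation.last_eq (h : IsAllocation s K M p Φ C) : C s = M := by
  have h1 := h.lower
  have h2 := h.upper
  have h3 := h.total
  omega

theorem IsAllocation.eq_add_sum (h : IsAllocation s K M p Φ C) {i : ℕ} (hi : 1 ≤ i)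
    (his : i ≤ s) : C i = K + ∑ j ∈ Icc 2 i, increments s C j := by
  induction i, hi using Nat.le_induction with
  | base => simp [h.first_eq]
  | succ i hi ih =>
    rw [sum_Icc_succ_top (by omega), ← add_assoc, ← ih (by omega), increments,
      if_pos (by rw [mem_Icc]; omega), Nat.add_sub_cancel]
    have := h.ordered i (by rw [mem_Ico]; omega)
    omega

theorem IsAllocation.accumulate_increments (h : IsAllocation s K M p Φ C) :
    accumulate s K (increments s C) = C := by
  funext i
  by_cases hi : i ∈ Icc 1 s
  · rw [accumulate_of_mem hi]
    rw [mem_Icc] at hi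
    exact (h.eq_add_sum hi.1 hi.2).symm
  · rw [accumulate, if_neg hi, h.support i hi]

theorem injOn_increments : Set.InjOn (increments s) (allocations s K M p Φ) := by
  intro C hC D hD hCD
  rw [← IsAllocation.accumulate_increments hC, ← IsAllocation.accumulate_increments hD, hCD]

theorem sum_accumulate_mul (s K : ℕ) (p : ℕ → ℝ) (n : ℕ → ℕ) :
    ∑ i ∈ Icc 1 s, (accumulate s K n i : ℝ) * p i
      = K * ∑ i ∈ Icc 1 s, p i + ∑ j ∈ Icc 2 s, tailPrice s p j * n j := by
  rw [← sum_mul_sum_Icc_eq, mul_sum, ← sum_add_distrib]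
  refine sum_congr rfl fun i hi => ?_
  rw [accumulate_of_mem hi]
  push_cast
  ring

theorem IsAllocation.sum_increments (h : IsAllocation s K M p Φ C) (hs : 1 ≤ s) :
    ∑ j ∈ Icc 2 s, (increments s C j : ℝ) = (M : ℝ) - K := by
  have h1 := h.eq_add_sum hs le_rfl
  rw [h.last_eq] at h1
  rw [h1]; push_cast; ring

theorem IsAllocation.sum_tailPrice_increments_le (h : IsAllocation s K M p Φ C) :
    ∑ j ∈ Icc 2 s, tailPrice s p j * increments s C j ≤ Φ - K * ∑ i ∈ Icc 1 s, p i := by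
  have h1 := h.budget
  rw [← h.accumulate_increments, sum_accumulate_mul] at h1
  linarith

theorem isAllocation_accumulate (hs : 1 ≤ s) (hKM : K ≤ M) (hp : ∀ i ∈ Icc 1 s, 0 ≤ p i)
    (hΦ : Φ ≤ M * ∑ i ∈ Icc 1 s, p i) {n : ℕ → ℕ} (hn : ∑ j ∈ Icc 2 s, n j = M - K)
    (hE : ∑ j ∈ Icc 2 s, tailPrice s p j * n j ≤ Φ - K * ∑ i ∈ Icc 1 s, p i) :
    IsAllocation s K M p Φ (accumulate s K n) := by
  have h1 : accumulate s K n 1 = K := by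
    rw [accumulate_of_mem (by rw [mem_Icc]; omega)]; simp
  have h2 : accumulate s K n s = M := by
    rw [accumulate_of_mem (by rw [mem_Icc]; omega), hn]; omega
  refine ⟨fun i hi => if_neg hi, fun i hi => ?_, h1.ge, h2.le, by rw [h1, h2], ?_, ?_, ?_⟩
  · rw [mem_Ico] at hi
    rw [accumulate_of_mem (by rw [mem_Icc]; omega), accumulate_of_mem (by rw [mem_Icc]; omega),
      sum_Icc_succ_top (by omega)]
    omega
  · rw [h1, sum_accumulate_mul]
    have : 0 ≤ ∑ j ∈ Icc 2 s, tailPrice s p j * n j := sum_nonneg fun j hj =>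
      mul_nonneg (tailPrice_nonneg hp (by rw [mem_Icc] at hj; omega)) (Nat.cast_nonneg _)
    linarith
  · rw [sum_accumulate_mul]; linarith
  · rw [h2]; exact hΦ

theorem injOn_accumulate :
    Set.InjOn (accumulate s K) {n | ∀ j ∉ Icc 2 s, n j = 0} := by
  intro n hn m hm h
  funext j
  by_cases hj : j ∈ Icc 2 s
  · have hj' := mem_Icc.1 hj
    obtain ⟨k, rfl⟩ : ∃ k, j = k + 1 := ⟨j - 1, by omega⟩
    have h1 := congrFun h k
    have h2 := congrFun h (k + 1)
    rw [accumulate_of_mem (by rw [mem_Icc]; omega), accumulate_of_mem (by rw [mem_Icc]; omega)]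
      at h1 h2
    rw [sum_Icc_succ_top (by omega), sum_Icc_succ_top (by omega)] at h2
    omega
  · rw [hn j hj, hm j hj]

theorem IsParameters.budget_tailPrice {β σ : ℝ} (h : IsParameters s K M p Φ β σ) :
    ∑ j ∈ Icc 2 s, tailPrice s p j * meanIncrement s p β σ j
      = Φ - K * ∑ i ∈ Icc 1 s, p i := by
  rw [← h.budget, sum_Icc_two_mul_sum_eq]

/-- All levels satisfy λ_j ≤ λ_1, so the mean energy is at most N λ_1. Thus the condition
`budget_upper` holds automatically. -/
theorem IsParameters.budget_le {β σ : ℝ} (h : IsParameters s K M p Φ β σ)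
    (hp : ∀ i ∈ Icc 1 s, 0 ≤ p i) : Φ ≤ M * ∑ i ∈ Icc 1 s, p i := by
  have h1 : ∑ j ∈ Icc 2 s, tailPrice s p j * meanIncrement s p β σ j
      ≤ ∑ j ∈ Icc 2 s, tailPrice s p 1 * meanIncrement s p β σ j := by
    refine sum_le_sum fun j hj => mul_le_mul_of_nonneg_right ?_ (geomMean_pos (h.pos j hj)).le
    exact tailPrice_le hp le_rfl (by rw [mem_Icc] at hj; omega)
  rw [← mul_sum, h.total, h.budget_tailPrice, tailPrice] at h1
  linarith

/-- On the exact shell, the geometric weight depends on the total price alone. -/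
theorem geomWeight_eq_exp {β σ : ℝ} {N : ℝ} (n : ℕ → ℕ) (hn : ∑ j ∈ Icc 2 s, (n j : ℝ) = N) :
    geomWeight (Icc 2 s) (fun j => β * tailPrice s p j - σ) n
      = (∏ j ∈ Icc 2 s, (1 - Real.exp (-(β * tailPrice s p j - σ)))) *
        Real.exp (σ * N - β * ∑ j ∈ Icc 2 s, tailPrice s p j * n j) := by
  rw [geomWeight, prod_mul_distrib, ← hn, mul_sum, mul_sum, ← sum_sub_distrib, Real.exp_sum]
  congr 1
  refine prod_congr rfl fun j _ => ?_
  rw [← Real.exp_nat_mul]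
  congr 1; ring

end Allocation

/-! ### Lower bound for the number of allocations -/

theorem Icc_two_eq_union {b s : ℕ} (hb : 1 ≤ b) (hbs : b < s) :
    Icc 2 s = Icc 2 b ∪ insert s (Ioo b s) := by
  ext j
  simp only [mem_union, mem_insert, mem_Icc, mem_Ioo]
  omega

theorem disjoint_Icc_insert_Ioo {b s : ℕ} (hbs : b < s) :
    Disjoint (Icc 2 b) (insert s (Ioo b s)) := by
  rw [disjoint_left]
  intro j
  simp only [mem_insert, mem_Icc, mem_Ioo]
  omega

theorem sum_Icc_two_split {b s : ℕ} (hb : 1 ≤ b) (hbs : b < s) (f : ℕ → ℝ) :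
    ∑ j ∈ Icc 2 s, f j = ∑ j ∈ Icc 2 b, f j + (f s + ∑ j ∈ Ioo b s, f j) := by
  rw [Icc_two_eq_union hb hbs, sum_union (disjoint_Icc_insert_Ioo hbs), sum_insert (by simp)]

theorem prod_Icc_two_split {b s : ℕ} (hb : 1 ≤ b) (hbs : b < s) (f : ℕ → ℝ) :
    ∏ j ∈ Icc 2 s, f j = (∏ j ∈ Icc 2 b, f j) * (f s * ∏ j ∈ Ioo b s, f j) := by
  rw [Icc_two_eq_union hb hbs, prod_union (disjoint_Icc_insert_Ioo hbs), prod_insert (by simp)]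

/-- The left side is at most 1/(1 + R) and the right side is 1/(1 + `geomMean x`). It bounds below
the probability that a position is empty. -/
theorem exp_neg_le_one_sub_exp_neg {x R : ℝ} (hx : 0 < x) (hR : geomMean x ≤ R) :
    Real.exp (-R) ≤ 1 - Real.exp (-x) := by
  have h := geomMean_pos hx
  rw [one_sub_exp_neg_eq hx, Real.exp_neg, ← one_div]
  exact one_div_le_one_div_of_le (by linarith) (by linarith [Real.add_one_le_exp R])

theorem le_one_div_of_le_geomMean {x μ : ℝ} (hμ : 0 < μ) (h : μ ≤ geomMean x) :
    x ≤ 1 / μ := by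
  rw [← Real.exp_le_exp, exp_eq_one_add_one_div_geomMean]
  have := one_div_le_one_div_of_le hμ h
  linarith [Real.add_one_le_exp (1 / μ)]

/-- Completing a configuration on `b < j < s` by the missing units at `s` costs a factor that is
exponential in the number of positions left empty and of units added. -/
theorem le_geomWeight_update {b s L : ℕ} {x : ℕ → ℝ} {μ R : ℝ} (hbL : b = L + 1) (hbs : b < s)
    (hx : ∀ j ∈ Icc 2 s, 0 < x j) (hμ : 0 < μ) (hR : ∀ j ∈ Icc 2 s, geomMean (x j) ≤ R)
    (hμs : μ ≤ geomMean (x s)) {n : ℕ → ℕ} (hn : ∀ j ∉ Ioo b s, n j = 0) (k : ℕ) :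
    geomWeight (Ioo b s) x n * Real.exp (-(R * (L + 1) + k / μ))
      ≤ geomWeight (Icc 2 s) x (Function.update n s k) := by
  have hsmem : s ∈ Icc 2 s := by rw [mem_Icc]; omega
  have hI : ∀ j ∈ Ioo b s, 0 < x j := fun j hj => hx j (by rw [mem_Ioo] at hj; rw [mem_Icc]; omega)
  rw [geomWeight, geomWeight, prod_Icc_two_split (by omega) hbs]
  have h1 : Real.exp (-R) ^ L ≤ ∏ j ∈ Icc 2 b,
      (1 - Real.exp (-x j)) * Real.exp (-x j) ^ (Function.update n s k) j := by
    have hc : #(Icc 2 b) = L := by rw [Nat.card_Icc]; omega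
    rw [← hc, ← prod_const]
    refine prod_le_prod (fun j _ => (Real.exp_pos _).le) fun j hj => ?_
    rw [mem_Icc] at hj
    have hjs : j ≠ s := by omega
    have hj' : j ∈ Icc 2 s := by rw [mem_Icc]; omega
    rw [Function.update_of_ne hjs, hn j (by rw [mem_Ioo]; omega), pow_zero, mul_one]
    exact exp_neg_le_one_sub_exp_neg (hx j hj') (hR j hj')
  have h2 : Real.exp (-R) * Real.exp (-(k / μ)) ≤
      (1 - Real.exp (-x s)) * Real.exp (-x s) ^ (Function.update n s k) s := by
    rw [Function.update_self, ← Real.exp_nat_mul]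
    refine mul_le_mul (exp_neg_le_one_sub_exp_neg (hx s hsmem) (hR s hsmem)) ?_
      (Real.exp_pos _).le ((Real.exp_pos _).le.trans
        (exp_neg_le_one_sub_exp_neg (hx s hsmem) (hR s hsmem)))
    apply Real.exp_le_exp.2
    have := mul_le_mul_of_nonneg_left (le_one_div_of_le_geomMean hμ hμs) (Nat.cast_nonneg (α := ℝ) k)
    rw [mul_one_div] at this
    linarith
  have h3 : ∏ j ∈ Ioo b s, (1 - Real.exp (-x j)) * Real.exp (-x j) ^ (Function.update n s k) j
      = geomWeight (Ioo b s) x n := by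
    refine prod_congr rfl fun j hj => ?_
    rw [mem_Ioo] at hj
    rw [Function.update_of_ne (by omega)]
  rw [h3]
  have h4 : Real.exp (-(R * (L + 1) + k / μ))
      = Real.exp (-R) ^ L * (Real.exp (-R) * Real.exp (-(k / μ))) := by
    rw [← Real.exp_nat_mul, ← Real.exp_add, ← Real.exp_add]; congr 1; ring
  have h5 := mul_le_mul h1 h2 (by positivity) (le_trans (by positivity) h1)
  rw [h4, ← mul_assoc (∏ j ∈ Icc 2 b, _), mul_comm (∏ j ∈ Ioo b s, _)]
  exact mul_le_mul_of_nonneg_right h5 (geomWeight_nonneg hI n)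

/-- Most configurations on `I` have small deviations of two given weighted sums. -/
theorem exists_concentrated {I : Finset ℕ} {x g : ℕ → ℝ} {R u t : ℝ} (hx : ∀ j ∈ I, 0 < x j)
    (hR0 : 0 ≤ R) (hR : ∀ j ∈ I, geomMean (x j) ≤ R) (hg : ∀ j ∈ I, |g j| ≤ 1) (hu0 : 0 ≤ u)
    (hu : u ≤ 1) (huR : 4 * R * u ≤ 1)
    (hsmall : Real.exp (-(u * t) + (R + 4 * R ^ 2) * u ^ 2 * #I) ≤ 1 / 16) :
    ∃ 𝓖 : Finset (ℕ → ℕ), 1 / 2 ≤ ∑ n ∈ 𝓖, geomWeight I x n ∧ ∀ n ∈ 𝓖, (∀ j ∉ I, n j = 0) ∧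
      |∑ j ∈ I, ((n j : ℝ) - geomMean (x j))| ≤ t ∧
      |∑ j ∈ I, g j * (n j - geomMean (x j))| ≤ t := by
  classical
  -- Two exceptional events of mass at most 1/8 each leave 1/2 out of 3/4.
  obtain ⟨T, hT⟩ := exists_boxFunctions_mass hx (θ := 3 / 4) (by norm_num)
  set 𝓑 := boxFunctions I T
  set Y : (ℕ → ℕ) → ℝ := fun n => ∑ j ∈ I, ((n j : ℝ) - geomMean (x j)) with hY
  set X : (ℕ → ℕ) → ℝ := fun n => ∑ j ∈ I, g j * (n j - geomMean (x j))
  have h0 : ∀ n ∈ 𝓑, ∀ j ∉ I, n j = 0 := fun n hn => (mem_boxFunctions.1 hn).1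
  refine ⟨{n ∈ 𝓑 | |Y n| ≤ t ∧ |X n| ≤ t}, ?_, fun n hn => ?_⟩
  · have hYb : ∑ n ∈ 𝓑 with ¬|Y n| ≤ t, geomWeight I x n ≤ 1 / 8 := by
      refine (geomWeight_chernoff_abs (g := fun _ => 1) (t := t) hx hR0 hR (by simp) hu0 hu huR
        (fun n hn => h0 n (mem_filter.1 hn).1) fun n hn => ?_).trans (by linarith)
      simp only [one_mul]
      exact (not_le.1 (mem_filter.1 hn).2).le
    have hXb : ∑ n ∈ 𝓑 with ¬|X n| ≤ t, geomWeight I x n ≤ 1 / 8 :=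
      (geomWeight_chernoff_abs (t := t) hx hR0 hR hg hu0 hu huR
        (fun n hn => h0 n (mem_filter.1 hn).1)
        fun n hn => (not_le.1 (mem_filter.1 hn).2).le).trans (by linarith)
    have h1 := sum_filter_add_sum_filter_not 𝓑 (fun n => |Y n| ≤ t ∧ |X n| ≤ t) (geomWeight I x)
    have h2 : ∑ n ∈ 𝓑 with ¬(|Y n| ≤ t ∧ |X n| ≤ t), geomWeight I x n
        ≤ ∑ n ∈ 𝓑 with ¬|Y n| ≤ t, geomWeight I x n
          + ∑ n ∈ 𝓑 with ¬|X n| ≤ t, geomWeight I x n := by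
      rw [← sum_union_inter]
      refine le_add_of_le_of_nonneg (sum_le_sum_of_subset_of_nonneg (fun n hn => ?_)
        fun n _ _ => geomWeight_nonneg hx n) (sum_nonneg fun n _ => geomWeight_nonneg hx n)
      simp only [mem_union, mem_filter] at hn ⊢
      tauto
    linarith
  · obtain ⟨h1, h2⟩ := mem_filter.1 hn
    exact ⟨h0 n h1, h2⟩

section Lower

variable {s K M : ℕ} {p : ℕ → ℝ} {Φ β σ : ℝ}

set_option maxHeartbeats 1000000 in
/-- A lower bound for the number of allocations, up to a factor exponential in `L`. -/
theorem half_le_ncard_allocations {L : ℕ} {β₀ B μ R u : ℝ} (hKM : K ≤ M)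
    (hp : ∀ i ∈ Icc 1 s, 0 ≤ p i) (hB : ∀ i ∈ Icc 1 s, tailPrice s p i ≤ B)
    (h : IsParameters s K M p Φ β σ) (hβ : 0 ≤ β) (hβ₀ : β ≤ β₀) (hμ : 0 < μ)
    (hμm : ∀ j ∈ Icc 2 s, μ ≤ meanIncrement s p β σ j)
    (hR : ∀ j ∈ Icc 2 s, meanIncrement s p β σ j ≤ R) (hL : 1 ≤ L) (hLs : L + 1 < s)
    (hu0 : 0 ≤ u) (hu : u ≤ 1) (huR : 4 * R * u ≤ 1)
    (hsmall : Real.exp (-(u * (μ * L)) + (R + 4 * R ^ 2) * u ^ 2 * s) ≤ 1 / 16) :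
    1 / 2 ≤ (allocations s K M p Φ).ncard *
      ((∏ j ∈ Icc 2 s, (1 - Real.exp (-(β * tailPrice s p j - σ)))) *
        Real.exp (σ * ((M : ℝ) - K) - β * (Φ - K * ∑ i ∈ Icc 1 s, p i)) *
        Real.exp ((2 * β₀ * B * R + 2 * R + 3 * R / μ) * L)) := by
  set x : ℕ → ℝ := fun j => β * tailPrice s p j - σ with hxdef
  set E := Φ - K * ∑ i ∈ Icc 1 s, p i with hE
  obtain ⟨b, hb⟩ : ∃ b, b = L + 1 := ⟨_, rfl⟩
  have hbs : b < s := by omega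
  have hb1 : 1 ≤ b := by omega
  set lam := tailPrice s p with hlam
  set m : ℕ → ℝ := fun j => geomMean (x j) with hm
  have hL1 : (1 : ℝ) ≤ L := by exact_mod_cast hL
  have hsmem : s ∈ Icc 2 s := by rw [mem_Icc]; omega
  have hμR : μ ≤ R := (hμm s hsmem).trans (hR s hsmem)
  have hR0 : 0 < R := hμ.trans_le hμR
  have hIsub : ∀ j ∈ Ioo b s, j ∈ Icc 2 s := fun j hj => by
    rw [mem_Ioo] at hj; rw [mem_Icc]; omega
  have hJsub : ∀ j ∈ Icc 2 b, j ∈ Icc 2 s := fun j hj => by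
    rw [mem_Icc] at hj ⊢; omega
  have hcardJ : #(Icc 2 b) = L := by rw [Nat.card_Icc]; omega
  have hB0 : 0 ≤ B := (tailPrice_nonneg hp le_rfl).trans (hB 1 (by rw [mem_Icc]; omega))
  -- With prices measured from the cheapest level, the units added at s cost nothing.
  set d : ℕ → ℝ := fun j => lam j - lam s with hd
  have hd0 : ∀ j, 1 ≤ j → j ≤ s → 0 ≤ d j := fun j h1 h2 => sub_nonneg.2 (tailPrice_le hp h1 h2)
  have hdB : ∀ j, 1 ≤ j → j ≤ s → d j ≤ B := fun j h1 h2 => by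
    have h3 : 0 ≤ lam s := tailPrice_nonneg hp (by omega)
    have h4 : lam j ≤ B := hB j (by rw [mem_Icc]; omega)
    simp only [hd]; linarith
  have hdb : ∀ j, 1 ≤ j → j ≤ b → d b ≤ d j := fun j h1 h2 =>
    sub_le_sub_right (tailPrice_le hp h1 h2) _
  have hdb' : ∀ j, b ≤ j → d j ≤ d b := fun j h2 => sub_le_sub_right (tailPrice_le hp hb1 h2) _
  -- As d is decreasing, g ≤ 1 beyond b. If d b = 0, then d vanishes beyond b and division by zero
  -- gives the correct g = 0.
  set g : ℕ → ℝ := fun j => d j / d b with hg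
  have hgd : ∀ j ∈ Ioo b s, d b * g j = d j := fun j hj => by
    rw [mem_Ioo] at hj
    rcases eq_or_ne (d b) 0 with h0 | h0
    · have := hd0 j (by omega) (by omega)
      have := hdb' j hj.1.le
      rw [h0, zero_mul]; linarith
    · exact mul_div_cancel₀ _ h0
  have hg1 : ∀ j ∈ Ioo b s, |g j| ≤ 1 := fun j hj => by
    rw [mem_Ioo] at hj
    have h1 := hd0 j (by omega) (by omega)
    have h2 := hd0 b hb1 hbs.le
    rw [hg, abs_of_nonneg (div_nonneg h1 h2)]
    exact div_le_one_of_le₀ (hdb' j hj.1.le) h2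
  have hcardI : ((#(Ioo b s) : ℕ) : ℝ) ≤ s := by
    rw [Nat.card_Ioo]; exact_mod_cast (by omega)
  -- The tolerance μL is a lower bound for the mean number of units on the emptied positions 2, …,
  -- b, so emptying them compensates any admitted fluctuation.
  obtain ⟨𝓖, hmass, h𝓖⟩ := exists_concentrated (I := Ioo b s) (x := x) (g := g) (R := R) (u := u)
    (t := μ * L) (fun j hj => h.pos j (hIsub j hj)) hR0.le (fun j hj => hR j (hIsub j hj)) hg1
    hu0 hu huR (le_trans (Real.exp_le_exp.2 (by gcongr)) hsmall)
  have htot : ∑ j ∈ Icc 2 b, m j + (m s + ∑ j ∈ Ioo b s, m j) = (M : ℝ) - K := by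
    rw [← sum_Icc_two_split hb1 hbs]; exact h.total
  have hmJ : μ * L ≤ ∑ j ∈ Icc 2 b, m j := by
    have := card_nsmul_le_sum (Icc 2 b) m μ fun j hj => hμm j (hJsub j hj)
    rwa [hcardJ, nsmul_eq_mul, mul_comm] at this
  have hmJ' : ∑ j ∈ Icc 2 b, m j ≤ R * L := by
    have := sum_le_card_nsmul (Icc 2 b) m R fun j hj => hR j (hJsub j hj)
    rwa [hcardJ, nsmul_eq_mul, mul_comm] at this
  have hms : μ ≤ m s := hμm s hsmem
  have hms' : m s ≤ R := hR s hsmem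
  have hdmJ : d b * (μ * L) ≤ ∑ j ∈ Icc 2 b, d j * m j := by
    have := card_nsmul_le_sum (Icc 2 b) (fun j => d j * m j) (d b * μ) fun j hj => by
      have hj' := mem_Icc.1 hj
      exact mul_le_mul (hdb j (by omega) hj'.2) (hμm j (hJsub j hj)) hμ.le
        (hd0 j (by omega) (by omega))
    rw [hcardJ, nsmul_eq_mul] at this
    linarith
  have hdmJ' : ∑ j ∈ Icc 2 b, d j * m j ≤ B * R * L := by
    have := sum_le_card_nsmul (Icc 2 b) (fun j => d j * m j) (B * R) fun j hj => by
      have hj' := mem_Icc.1 hj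
      exact mul_le_mul (hdB j (by omega) (by omega)) (hR j (hJsub j hj))
        (hμ.le.trans (hμm j (hJsub j hj))) hB0
    rw [hcardJ, nsmul_eq_mul] at this
    linarith
  have hEsplit : E = lam s * ((M : ℝ) - K) + (∑ j ∈ Icc 2 b, d j * m j
      + ∑ j ∈ Ioo b s, d j * m j) := by
    have h1 : ∑ j ∈ Icc 2 s, lam j * m j = E := h.budget_tailPrice
    have h2 : ∑ j ∈ Icc 2 s, lam j * m j
        = lam s * ∑ j ∈ Icc 2 s, m j + ∑ j ∈ Icc 2 s, d j * m j := by
      rw [mul_sum, ← sum_add_distrib]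
      exact sum_congr rfl fun j _ => by simp only [hd]; ring
    rw [← h1, h2, sum_Icc_two_split hb1 hbs m, htot,
      sum_Icc_two_split hb1 hbs fun j => d j * m j]
    simp [hd]
  set fill : (ℕ → ℕ) → ℕ → ℕ := fun n => Function.update n s (M - K - ∑ j ∈ Ioo b s, n j)
    with hfill
  have hfillI : ∀ n, ∀ j ∈ Ioo b s, fill n j = n j := fun n j hj => by
    rw [mem_Ioo] at hj
    rw [hfill]; exact Function.update_of_ne (by omega) _ _
  have hkey : ∀ n ∈ 𝓖, (∀ j ∉ Icc 2 s, fill n j = 0) ∧ ∑ j ∈ Icc 2 s, fill n j = M - K ∧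
      ∑ j ∈ Icc 2 s, lam j * fill n j ≤ E ∧
      geomWeight (Ioo b s) x n ≤ (∏ j ∈ Icc 2 s, (1 - Real.exp (-(β * lam j - σ)))) *
        Real.exp (σ * ((M : ℝ) - K) - β * E) *
        Real.exp ((2 * β₀ * B * R + 2 * R + 3 * R / μ) * L) := by
    intro n hn
    obtain ⟨hn0, hY, hX⟩ := h𝓖 n hn
    rw [sum_sub_distrib, abs_le] at hY
    -- The mean over the middle block is at most N - μL and the deviation at most μL; hence the
    -- truncated subtraction in `fill` is exact.
    have hkle : (∑ j ∈ Ioo b s, n j) ≤ M - K := by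
      have : ((∑ j ∈ Ioo b s, n j : ℕ) : ℝ) ≤ ((M - K : ℕ) : ℝ) := by
        rw [Nat.cast_sub hKM, Nat.cast_sum]; linarith [hY.2]
      exact_mod_cast this
    obtain ⟨k, hk⟩ : ∃ k, k = M - K - ∑ j ∈ Ioo b s, n j := ⟨_, rfl⟩
    have hkR : (k : ℝ) = (M : ℝ) - K - ∑ j ∈ Ioo b s, (n j : ℝ) := by
      rw [hk, Nat.cast_sub hkle, Nat.cast_sub hKM, Nat.cast_sum]
    have hfs : fill n s = k := by rw [hfill, hk]; exact Function.update_self _ _ _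
    have hfJ : ∀ j ∈ Icc 2 b, fill n j = 0 := fun j hj => by
      rw [mem_Icc] at hj
      rw [hfill]
      exact (Function.update_of_ne (by omega) _ _).trans (hn0 j (by rw [mem_Ioo]; omega))
    have hsum : ∀ f : ℕ → ℝ, ∑ j ∈ Icc 2 s, f j * fill n j
        = f s * k + ∑ j ∈ Ioo b s, f j * n j := fun f => by
      rw [sum_Icc_two_split hb1 hbs, hfs, sum_eq_zero fun j hj => by rw [hfJ j hj]; simp, zero_add,
        sum_congr rfl fun j hj => by rw [hfillI n j hj]]
    have hsum1 : ∑ j ∈ Icc 2 s, (fill n j : ℝ) = (M : ℝ) - K := by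
      have := hsum fun _ => 1
      simp only [one_mul] at this
      rw [this, hkR]; ring
    -- The unspent budget is the saving on the emptied block, at least d_b μL, minus d_b times a
    -- deviation of size at most μL.
    have hprice : E - ∑ j ∈ Icc 2 s, lam j * fill n j = ∑ j ∈ Icc 2 b, d j * m j
        - d b * ∑ j ∈ Ioo b s, g j * (n j - m j) := by
      have h1 : ∑ j ∈ Ioo b s, lam j * (n j : ℝ)
          = lam s * ∑ j ∈ Ioo b s, (n j : ℝ) + ∑ j ∈ Ioo b s, d j * (n j : ℝ) := by
        rw [mul_sum, ← sum_add_distrib]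
        exact sum_congr rfl fun j _ => by simp only [hd]; ring
      have h2 : d b * ∑ j ∈ Ioo b s, g j * (n j - m j)
          = ∑ j ∈ Ioo b s, d j * (n j : ℝ) - ∑ j ∈ Ioo b s, d j * m j := by
        rw [mul_sum, ← sum_sub_distrib]
        exact sum_congr rfl fun j hj => by rw [← mul_assoc, hgd j hj]; ring
      rw [hsum, h1, h2, hEsplit, hkR]; ring
    have hdb0 := hd0 b hb1 hbs.le
    have hXle := abs_le.1 hX
    have hlow : 0 ≤ E - ∑ j ∈ Icc 2 s, lam j * fill n j := by
      rw [hprice]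
      linarith [mul_le_mul_of_nonneg_left hXle.2 hdb0]
    have hupp : E - ∑ j ∈ Icc 2 s, lam j * fill n j ≤ 2 * B * R * L := by
      have h1 := mul_le_mul_of_nonneg_left hXle.1 hdb0
      have h2 : d b * (μ * L) ≤ B * (R * L) :=
        mul_le_mul (hdB b hb1 hbs.le) (mul_le_mul_of_nonneg_right hμR (by positivity))
          (by positivity) hB0
      rw [hprice]
      linarith
    refine ⟨fun j hj => ?_, ?_, by linarith, ?_⟩
    · have hjs : j ≠ s := fun e => hj (e ▸ hsmem)
      rw [hfill]
      exact (Function.update_of_ne hjs _ _).trans (hn0 j fun h' => hj (hIsub j h'))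
    · have : ((∑ j ∈ Icc 2 s, fill n j : ℕ) : ℝ) = ((M - K : ℕ) : ℝ) := by
        rw [Nat.cast_sub hKM, Nat.cast_sum, hsum1]
      exact_mod_cast this
    · have hw := le_geomWeight_update hb hbs h.pos hμ hR (hμm s hsmem) hn0 k
      have hfe : Function.update n s k = fill n := by rw [hfill, hk]
      rw [hfe, geomWeight_eq_exp (N := (M : ℝ) - K) (fill n) hsum1] at hw
      -- The units come from the means on the emptied block, the mean at s and the deviation; each
      -- is at most RL.
      have hk3 : (k : ℝ) ≤ 3 * R * L := by
        rw [hkR]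
        have h1 : μ * L ≤ R * L := mul_le_mul_of_nonneg_right hμR (by positivity)
        have h2 : R ≤ R * L := le_mul_of_one_le_right hR0.le hL1
        linarith [hY.1]
      have hkμ : (k : ℝ) / μ ≤ 3 * R / μ * L := by
        rw [div_mul_eq_mul_div]
        exact div_le_div_of_nonneg_right hk3 hμ.le
      have hRL : R * (L + 1) ≤ 2 * R * L := by
        have : R * 1 ≤ R * L := mul_le_mul_of_nonneg_left hL1 hR0.le
        linarith
      have hββ : β * (E - ∑ j ∈ Icc 2 s, lam j * fill n j) ≤ β₀ * (2 * B * R * L) :=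
        mul_le_mul hβ₀ hupp hlow (hβ.trans hβ₀)
      set W := ∏ j ∈ Icc 2 s, (1 - Real.exp (-(β * lam j - σ))) with hW
      have hW0 : 0 ≤ W := prod_nonneg fun j hj =>
        (Real.exp_pos _).le.trans (exp_neg_le_one_sub_exp_neg (h.pos j hj) (hR j hj))
      have hw' : geomWeight (Ioo b s) x n
          ≤ W * Real.exp (σ * ((M : ℝ) - K) - β * ∑ j ∈ Icc 2 s, lam j * fill n j) *
            Real.exp (R * (L + 1) + k / μ) := by
        have := mul_le_mul_of_nonneg_right hw (Real.exp_pos (R * (L + 1) + k / μ)).le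
        rwa [mul_assoc, ← Real.exp_add, neg_add_cancel, Real.exp_zero, mul_one] at this
      refine hw'.trans ?_
      rw [mul_assoc, mul_assoc, ← Real.exp_add, ← Real.exp_add]
      refine mul_le_mul_of_nonneg_left (Real.exp_le_exp.2 ?_) hW0
      linarith
  set V := (∏ j ∈ Icc 2 s, (1 - Real.exp (-(β * lam j - σ)))) *
        Real.exp (σ * ((M : ℝ) - K) - β * E) *
        Real.exp ((2 * β₀ * B * R + 2 * R + 3 * R / μ) * L) with hV
  have hV0 : 0 ≤ V := by
    have hW0 : 0 ≤ ∏ j ∈ Icc 2 s, (1 - Real.exp (-(β * lam j - σ))) := prod_nonneg fun j hj =>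
      (Real.exp_pos _).le.trans (exp_neg_le_one_sub_exp_neg (h.pos j hj) (hR j hj))
    positivity
  -- Filling is injective: it changes nothing on the middle block, outside which members of 𝓖
  -- vanish.
  have hcard : #𝓖 ≤ (allocations s K M p Φ).ncard := by
    rw [← Set.ncard_coe_finset]
    refine Set.ncard_le_ncard_of_injOn (fun n => accumulate s K (fill n)) (fun n hn => ?_) ?_
      (allocations_finite s K M p Φ)
    · obtain ⟨-, h2, h3, -⟩ := hkey n hn
      exact isAllocation_accumulate (by omega) hKM hp (h.budget_le hp) h2 h3
    · intro n hn n' hn' heq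
      have hf := injOn_accumulate (hkey n hn).1 (hkey n' hn').1 heq
      funext j
      by_cases hj : j ∈ Ioo b s
      · rw [← hfillI n j hj, ← hfillI n' j hj, hf]
      · rw [(h𝓖 n hn).1 j hj, (h𝓖 n' hn').1 j hj]
  calc (1 : ℝ) / 2 ≤ ∑ n ∈ 𝓖, geomWeight (Ioo b s) x n := hmass
    _ ≤ ∑ _n ∈ 𝓖, V := sum_le_sum fun n hn => (hkey n hn).2.2.2
    _ = #𝓖 * V := by rw [sum_const, nsmul_eq_mul]
    _ ≤ _ := mul_le_mul_of_nonneg_right (by exact_mod_cast hcard) hV0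

end Lower

/-! ### Upper bound for the allocations outside the cluster -/

section Upper

variable {s K M : ℕ} {p : ℕ → ℝ} {Φ β σ : ℝ}

/-- With β ≥ 0, spending less than the budget only increases the weight. -/
theorem IsAllocation.exp_le_geomWeight {C : ℕ → ℕ} (hC : IsAllocation s K M p Φ C) (hs : 1 ≤ s)
    (hβ : 0 ≤ β) (hpos : ∀ j ∈ Icc 2 s, 0 < β * tailPrice s p j - σ) :
    (∏ j ∈ Icc 2 s, (1 - Real.exp (-(β * tailPrice s p j - σ)))) *
        Real.exp (σ * ((M : ℝ) - K) - β * (Φ - K * ∑ i ∈ Icc 1 s, p i))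
      ≤ geomWeight (Icc 2 s) (fun j => β * tailPrice s p j - σ) (increments s C) := by
  rw [geomWeight_eq_exp _ (hC.sum_increments hs)]
  refine mul_le_mul_of_nonneg_left (Real.exp_le_exp.2 ?_) (prod_nonneg fun j hj => ?_)
  · have := mul_le_mul_of_nonneg_left hC.sum_tailPrice_increments_le hβ
    linarith
  · exact (Real.exp_pos _).le.trans (exp_neg_le_one_sub_exp_neg (hpos j hj) le_rfl)

theorem IsAllocation.deviation_eq {C : ℕ → ℕ} (hC : IsAllocation s K M p Φ C) {i : ℕ}
    (hi : i ∈ Icc 1 s) (m : ℕ → ℝ) :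
    (C i : ℝ) - (C 1 + ∑ j ∈ Icc 2 i, m j)
      = ∑ j ∈ Icc 2 s, (if j ≤ i then 1 else 0) * ((increments s C j : ℝ) - m j) := by
  rw [mem_Icc] at hi
  have h1 : Icc 2 i = {j ∈ Icc 2 s | j ≤ i} := by
    ext j; simp only [mem_filter, mem_Icc]; omega
  simp only [ite_mul, one_mul, zero_mul]
  rw [← sum_filter, ← h1, sum_sub_distrib, hC.first_eq, hC.eq_add_sum hi.1 hi.2]
  push_cast
  ring

/-- An upper bound for the number of allocations outside the cluster. -/
theorem ncard_diff_cluster_mul_le {A δ R u : ℝ} (hs : 2 ≤ s)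
    (h : IsParameters s K M p Φ β σ) (hβ : 0 ≤ β)
    (hR : ∀ j ∈ Icc 2 s, meanIncrement s p β σ j ≤ R)
    (hu0 : 0 ≤ u) (hu : u ≤ 1) (huR : 4 * R * u ≤ 1) :
    (allocations s K M p Φ \ cluster s K M p Φ β σ δ A).ncard *
      ((∏ j ∈ Icc 2 s, (1 - Real.exp (-(β * tailPrice s p j - σ)))) *
        Real.exp (σ * ((M : ℝ) - K) - β * (Φ - K * ∑ i ∈ Icc 1 s, p i)))
      ≤ s * (2 * Real.exp (-(u * (A * ((M : ℝ) - K) ^ (3 / 4 : ℝ)))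
          + (R + 4 * R ^ 2) * u ^ 2 * s)) := by
  classical
  set x : ℕ → ℝ := fun j => β * tailPrice s p j - σ with hx
  set t := A * ((M : ℝ) - K) ^ (3 / 4 : ℝ) with ht
  set V := (∏ j ∈ Icc 2 s, (1 - Real.exp (-(β * tailPrice s p j - σ)))) *
        Real.exp (σ * ((M : ℝ) - K) - β * (Φ - K * ∑ i ∈ Icc 1 s, p i)) with hV
  have hR0 : 0 ≤ R := by
    have hsm : s ∈ Icc 2 s := by rw [mem_Icc]; omega
    exact (geomMean_pos (h.pos s hsm)).le.trans (hR s hsm)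
  have hfin : (allocations s K M p Φ \ cluster s K M p Φ β σ δ A).Finite :=
    (allocations_finite s K M p Φ).subset Set.sdiff_subset
  set F := hfin.toFinset with hF
  have hFa : ∀ C ∈ F, IsAllocation s K M p Φ C := fun C hC => ((hfin.mem_toFinset).1 hC).1
  set D : ℕ → (ℕ → ℕ) → ℝ := fun i n =>
    ∑ j ∈ Icc 2 s, (if j ≤ i then 1 else 0) * ((n j : ℝ) - geomMean (x j)) with hD
  have hdev : ∀ C ∈ F, ∃ i ∈ Icc 1 s, t ≤ |D i (increments s C)| := fun C hC => by
    have h1 := (hfin.mem_toFinset).1 hC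
    have h2 := h1.2
    simp only [cluster, Set.mem_ofPred_eq, h1.1, true_and] at h2
    push Not at h2
    obtain ⟨i, hi, -, h3⟩ := h2
    refine ⟨i, hi, ?_⟩
    rw [(hFa C hC).deviation_eq hi] at h3
    exact h3.le
  have hinj : Set.InjOn (increments s) (F : Set (ℕ → ℕ)) := fun C hC C' hC' =>
    injOn_increments (hFa C hC) (hFa C' hC')
  set w := geomWeight (Icc 2 s) x with hw
  have hw0 : ∀ n, 0 ≤ w n := geomWeight_nonneg h.pos
  rw [Set.ncard_eq_toFinset_card _ hfin]
  calc (#F : ℝ) * V = ∑ _C ∈ F, V := by rw [sum_const, nsmul_eq_mul]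
    _ ≤ ∑ C ∈ F, w (increments s C) :=
        sum_le_sum fun C hC => (hFa C hC).exp_le_geomWeight (by omega) hβ h.pos
    _ = ∑ n ∈ F.image (increments s), w n := (sum_image hinj).symm
    -- Union bound over the index i at which the partial sum deviates.
    _ ≤ ∑ n ∈ F.image (increments s), ∑ i ∈ Icc 1 s, if t ≤ |D i n| then w n else 0 := by
        refine sum_le_sum fun n hn => ?_
        obtain ⟨C, hC, rfl⟩ := mem_image.1 hn
        obtain ⟨i, hi, hti⟩ := hdev C hC
        calc w (increments s C)
            = if t ≤ |D i (increments s C)| then w (increments s C) else 0 := (if_pos hti).symm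
          _ ≤ _ := single_le_sum
              (f := fun i => if t ≤ |D i (increments s C)| then w (increments s C) else 0)
              (fun k _ => by split_ifs <;> simp [hw0]) hi
    _ = ∑ i ∈ Icc 1 s, ∑ n ∈ F.image (increments s) with t ≤ |D i n|, w n := by
        rw [sum_comm]
        exact sum_congr rfl fun i _ => (sum_filter _ _).symm
    _ ≤ ∑ _i ∈ Icc 1 s, 2 * Real.exp (-(u * t) + (R + 4 * R ^ 2) * u ^ 2 * s) := by
        refine sum_le_sum fun i _ => ?_
        refine (geomWeight_chernoff_abs (t := t) (R := R) (u := u)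
          (g := fun j => if j ≤ i then 1 else 0) h.pos hR0 hR
          (fun j _ => by split_ifs <;> simp) hu0 hu huR (fun n hn j hj => ?_)
          fun n hn => (mem_filter.1 hn).2).trans ?_
        · obtain ⟨C, -, rfl⟩ := mem_image.1 (mem_filter.1 hn).1
          exact if_neg hj
        · have : ((#(Icc 2 s) : ℕ) : ℝ) ≤ s := by
            rw [Nat.card_Icc]; exact_mod_cast (by omega)
          gcongr
    _ = _ := by rw [sum_const, Nat.card_Icc, nsmul_eq_mul, Nat.add_sub_cancel]

end Upper

/-! ### Uniform bounds for the means and choice of the constants -/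

/-- Under either of the two alternatives, the mean increments are bounded above and below. -/
theorem exists_meanIncrement_bounds (a₁ a₂ B β₀ R : ℝ) (ha₁ : 0 < a₁) :
    ∃ μ R' : ℝ, 0 < μ ∧ ∃ N₁ : ℕ, ∀ (s K M : ℕ) (p : ℕ → ℝ) (Φ β σ : ℝ),
      K < M → (N₁ : ℝ) ≤ (M : ℝ) - K → a₁ * ((M : ℝ) - K) ≤ s → (s : ℝ) ≤ a₂ * ((M : ℝ) - K) →
      (∀ i ∈ Icc 1 s, 0 ≤ p i) → (∀ i ∈ Icc 1 s, tailPrice s p i ≤ B) →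
      IsParameters s K M p Φ β σ → 0 ≤ β → β ≤ β₀ →
      (Real.exp (β₀ * B) < 1 + a₁ ∨ ∀ j ∈ Icc 2 s, meanIncrement s p β σ j ≤ R) →
      2 ≤ s ∧ ∀ j ∈ Icc 2 s, μ ≤ meanIncrement s p β σ j ∧ meanIncrement s p β σ j ≤ R' := by
  -- The exponents x_j differ by at most β₀B, and the smallest mean, at j = 2, is at most N/(s - 1).
  -- So e^{x_2} is at least about 1 + a₁, and e^{x_s} at least about 1 + ε.
  set ε := (1 + a₁) / Real.exp (β₀ * B) - 1 with hε
  refine ⟨1 / (Real.exp (β₀ * B) * (1 + |a₂|)), max R (2 / ε), by positivity,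
    ⌈2 / ε⌉₊ + ⌈2 / a₁⌉₊, ?_⟩
  intro s K M p Φ β σ hKM hN hs₁ hs₂ hp hB h hβ hβ₀ halt
  set N := (M : ℝ) - K with hNdef
  have hN0 : 0 < N := by rw [hNdef, sub_pos]; exact_mod_cast hKM
  push_cast at hN
  have hNε : 2 / ε ≤ N := by
    linarith [Nat.le_ceil (2 / ε), Nat.cast_nonneg (α := ℝ) ⌈2 / a₁⌉₊]
  have hNa : 2 / a₁ ≤ N := by
    linarith [Nat.le_ceil (2 / a₁), Nat.cast_nonneg (α := ℝ) ⌈2 / ε⌉₊]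
  have hs : 2 ≤ s := by
    rw [div_le_iff₀ ha₁] at hNa
    have : (2 : ℝ) ≤ s := by linarith
    exact_mod_cast this
  refine ⟨hs, ?_⟩
  set x : ℕ → ℝ := fun j => β * tailPrice s p j - σ with hx
  have hm : ∀ j, meanIncrement s p β σ j = geomMean (x j) := fun j => rfl
  simp only [hm] at halt ⊢
  have htot : ∑ j ∈ Icc 2 s, geomMean (x j) = N := h.total
  have hpos : ∀ j ∈ Icc 2 s, 0 < x j := h.pos
  have hsm : s ∈ Icc 2 s := by rw [mem_Icc]; omega
  have h2m : 2 ∈ Icc 2 s := by rw [mem_Icc]; omega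
  have hB0 : 0 ≤ B := (tailPrice_nonneg hp le_rfl).trans (hB 1 (by rw [mem_Icc]; omega))
  have hβ₀0 : 0 ≤ β₀ := hβ.trans hβ₀
  have hanti : ∀ i j, 2 ≤ i → i ≤ j → j ≤ s → x j ≤ x i := fun i j h1 h2 h3 =>
    sub_le_sub_right (mul_le_mul_of_nonneg_left (tailPrice_le hp (by omega) h2) hβ) _
  have hmono : ∀ i j, 2 ≤ i → i ≤ j → j ≤ s → geomMean (x i) ≤ geomMean (x j) :=
    fun i j h1 h2 h3 => by
      have := hpos j (by rw [mem_Icc]; omega)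
      exact one_div_le_one_div_of_le (sub_pos.2 (Real.one_lt_exp_iff.2 this))
        (sub_le_sub_right (Real.exp_le_exp.2 (hanti i j h1 h2 h3)) _)
  have hspread : ∀ j ∈ Icc 2 s, x j ≤ β₀ * B + x s := fun j hj => by
    rw [mem_Icc] at hj
    have h1 : tailPrice s p j - tailPrice s p s ≤ B := by
      have := hB j (by rw [mem_Icc]; omega)
      have := tailPrice_nonneg hp (j := s) (by omega)
      linarith
    have h2 : β * (tailPrice s p j - tailPrice s p s) ≤ β₀ * B := by
      have h0 : 0 ≤ tailPrice s p j - tailPrice s p s :=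
        sub_nonneg.2 (tailPrice_le hp (by omega) hj.2)
      exact mul_le_mul hβ₀ h1 h0 hβ₀0
    simp only [hx]; linarith
  have hcard : ((#(Icc 2 s) : ℕ) : ℝ) = s - 1 := by
    rw [Nat.card_Icc, Nat.cast_sub (by omega)]; push_cast; ring
  have hm2 := geomMean_pos (hpos 2 h2m)
  have hms := geomMean_pos (hpos s hsm)
  intro j hj
  constructor
  -- The largest mean is at least the average, which bounds x_s above; the spread bound then reaches
  -- every x_j.
  · have h1 : N ≤ s * geomMean (x s) := by
      have := sum_le_card_nsmul (Icc 2 s) (fun j => geomMean (x j)) (geomMean (x s)) fun j hj =>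
        hmono j s (mem_Icc.1 hj).1 (mem_Icc.1 hj).2 le_rfl
      rw [htot, nsmul_eq_mul, hcard] at this
      linarith
    have h2 : 1 / geomMean (x s) ≤ |a₂| := by
      rw [div_le_iff₀ hms]
      have h3 : (s : ℝ) * geomMean (x s) ≤ |a₂| * N * geomMean (x s) :=
        mul_le_mul_of_nonneg_right
          (hs₂.trans (mul_le_mul_of_nonneg_right (le_abs_self _) hN0.le)) hms.le
      by_contra hcon
      rw [not_le] at hcon
      have := mul_lt_mul_of_pos_right hcon hN0
      linarith
    have h3 : Real.exp (x j) ≤ Real.exp (β₀ * B) * (1 + |a₂|) := by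
      calc Real.exp (x j) ≤ Real.exp (β₀ * B) * Real.exp (x s) := by
            rw [← Real.exp_add]; exact Real.exp_le_exp.2 (hspread j hj)
        _ ≤ _ := by
            refine mul_le_mul_of_nonneg_left ?_ (Real.exp_pos _).le
            rw [exp_eq_one_add_one_div_geomMean (x s)]
            linarith
    exact one_div_le_one_div_of_le (sub_pos.2 (Real.one_lt_exp_iff.2 (hpos j hj))) (by linarith)
  · rcases halt with halt | halt
    · refine le_max_of_le_right ((hmono j s (mem_Icc.1 hj).1 (mem_Icc.1 hj).2 le_rfl).trans ?_)
      have hε0 : 0 < ε := by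
        rw [hε, sub_pos, one_lt_div (Real.exp_pos _)]; exact halt
      have h1 : (s - 1) * geomMean (x 2) ≤ N := by
        have := card_nsmul_le_sum (Icc 2 s) (fun j => geomMean (x j)) (geomMean (x 2)) fun j hj =>
          hmono 2 j le_rfl (mem_Icc.1 hj).1 (mem_Icc.1 hj).2
        rwa [htot, nsmul_eq_mul, hcard] at this
      have h2 : a₁ - 1 / N ≤ 1 / geomMean (x 2) := by
        have h3 : a₁ - 1 / N ≤ (s - 1) / N := by
          rw [le_div_iff₀ hN0, sub_mul, one_div_mul_cancel hN0.ne']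
          linarith
        refine h3.trans ?_
        rw [div_le_div_iff₀ hN0 hm2]
        linarith
      have h3 : Real.exp (x 2) ≤ Real.exp (β₀ * B) * Real.exp (x s) := by
        rw [← Real.exp_add]; exact Real.exp_le_exp.2 (hspread 2 h2m)
      have h4 : 1 + a₁ - 1 / N ≤ Real.exp (β₀ * B) * Real.exp (x s) := by
        rw [exp_eq_one_add_one_div_geomMean (x 2)] at h3
        linarith
      have h5 : 1 + ε - 1 / N ≤ Real.exp (x s) := by
        have hee : 1 ≤ Real.exp (β₀ * B) := Real.one_le_exp (by positivity)
        have h6 : Real.exp (β₀ * B) * (1 + ε) = 1 + a₁ := by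
          rw [hε]; field_simp; ring
        have h7 : 1 / N ≤ Real.exp (β₀ * B) * (1 / N) :=
          le_mul_of_one_le_left (by positivity) hee
        refine le_of_mul_le_mul_left ?_ (Real.exp_pos (β₀ * B))
        linarith
      have h6 : 1 / N ≤ ε / 2 := by
        rw [div_le_iff₀ hε0] at hNε
        rw [div_le_div_iff₀ hN0 two_pos]
        linarith
      have h7 : ε / 2 ≤ Real.exp (x s) - 1 := by linarith
      calc geomMean (x s) ≤ 1 / (ε / 2) := one_div_le_one_div_of_le (by positivity) h7
        _ = 2 / ε := by rw [one_div_div]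
    · exact le_max_of_le_left (halt j hj)

/-- A threshold beyond which the asymptotic inequalities of the counting argument hold. -/
theorem exists_threshold (a₁ a R κ c : ℝ) (ha₁ : 0 < a₁) (hc : 0 < c) (m : ℕ) :
    ∃ r₀ : ℝ, 1 ≤ r₀ ∧ ∀ r, r₀ ≤ r → 4 * R ≤ r ∧ κ * r ^ 2 + 3 ≤ a₁ * r ^ 4 ∧
      4 * a * r ^ 4 * Real.exp (-r ^ 2) < c / (r ^ 4) ^ m := by
  -- Here r stands for N^{1/4}; the extra power r⁴ pays for the factor s of the union bound.
  have h := (Real.tendsto_pow_mul_exp_neg_atTop_nhds_zero (4 * (m + 1))).eventually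
    (gt_mem_nhds (show (0 : ℝ) < c / (4 * |a| + 1) by positivity))
  obtain ⟨r₁, hr₁⟩ := Filter.eventually_atTop.1 h
  refine ⟨max (max 1 (4 * R)) (max r₁ ((κ + 3) / a₁)), le_max_of_le_left (le_max_left _ _),
    fun r hr => ?_⟩
  simp only [max_le_iff] at hr
  obtain ⟨⟨h1, h2⟩, h3, h4⟩ := hr
  have hr0 : 0 < r := by linarith
  refine ⟨h2, ?_, ?_⟩
  · rw [div_le_iff₀ ha₁] at h4
    have h5 : 1 ≤ r ^ 2 := one_le_pow₀ h1
    have h6 : r ≤ r ^ 2 := le_self_pow₀ h1 two_ne_zero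
    have h7 : (κ + 3) * r ^ 2 ≤ a₁ * r ^ 4 := by
      calc (κ + 3) * r ^ 2 ≤ (r ^ 2 * a₁) * r ^ 2 := by
            refine mul_le_mul_of_nonneg_right (h4.trans ?_) (by positivity)
            exact mul_le_mul_of_nonneg_right h6 ha₁.le
        _ = a₁ * r ^ 4 := by ring
    linarith
  · have h5 := hr₁ r h3
    rw [lt_div_iff₀ (by positivity)] at h5 ⊢
    have h6 : Real.exp (-r ^ 2) ≤ Real.exp (-r) :=
      Real.exp_le_exp.2 (neg_le_neg (le_self_pow₀ h1 two_ne_zero))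
    calc 4 * a * r ^ 4 * Real.exp (-r ^ 2) * (r ^ 4) ^ m
        = 4 * a * (r ^ (4 * (m + 1)) * Real.exp (-r ^ 2)) := by ring
      _ ≤ (4 * |a| + 1) * (r ^ (4 * (m + 1)) * Real.exp (-r)) := by
          refine mul_le_mul (by linarith [le_abs_self a])
            (mul_le_mul_of_nonneg_left h6 (by positivity)) (by positivity) (by positivity)
      _ < c := by linarith

/-- The allocations of the cluster form an overwhelming majority. -/
theorem exists_cluster_constant (a₁ a₂ B β₀ R δ : ℝ) (ha₁ : 0 < a₁) :
    ∃ A : ℝ, 0 < A ∧ ∀ (m : ℕ) (c : ℝ), 0 < c → ∃ N₀ : ℕ,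
      ∀ (s K M : ℕ) (p : ℕ → ℝ) (Φ β σ : ℝ),
        K < M → (N₀ : ℝ) ≤ (M : ℝ) - K →
        a₁ * ((M : ℝ) - K) ≤ s → (s : ℝ) ≤ a₂ * ((M : ℝ) - K) →
        (∀ i ∈ Icc 1 s, 0 ≤ p i) → (∀ i ∈ Icc 1 s, tailPrice s p i ≤ B) →
        IsParameters s K M p Φ β σ → 0 ≤ β → β ≤ β₀ →
        (Real.exp (β₀ * B) < 1 + a₁ ∨ ∀ j ∈ Icc 2 s, meanIncrement s p β σ j ≤ R) →
        ((allocations s K M p Φ \ cluster s K M p Φ β σ δ A).ncard : ℝ)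
          < c / ((M : ℝ) - K) ^ m * ((allocations s K M p Φ).ncard : ℝ) := by
  obtain ⟨μ, R', hμ, N₁, hbounds⟩ := exists_meanIncrement_bounds a₁ a₂ B β₀ R ha₁
  obtain ⟨Q, hQ⟩ : ∃ Q, Q = |R'| + 4 * |R'| ^ 2 := ⟨_, rfl⟩
  have hQ0 : 0 ≤ Q := by rw [hQ]; positivity
  -- With u = 1/r² and L ≥ κr², the gain uμL is at least Q|a₂| + 3: the first term covers the
  -- variance, and e^{-3} ≤ 1/16.
  obtain ⟨κ, hκ⟩ : ∃ κ, κ = (Q * |a₂| + 3) / μ := ⟨_, rfl⟩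
  have hκ0 : 0 ≤ κ := by rw [hκ]; positivity
  obtain ⟨Γ, hΓ⟩ : ∃ Γ, Γ = 2 * |β₀ * B| * |R'| + 2 * |R'| + 3 * |R'| / μ := ⟨_, rfl⟩
  have hΓ0 : 0 ≤ Γ := by rw [hΓ]; positivity
  -- In units of √N: Q|a₂| covers the variance, Γ(κ + 1) the loss exp(ΓL) of the lower bound, and 1
  -- leaves e^{-√N} to beat every power of N.
  refine ⟨Q * |a₂| + Γ * (κ + 1) + 1, by positivity, fun m c hc => ?_⟩
  obtain ⟨r₀, hr₀, hthr⟩ := exists_threshold a₁ |a₂| |R'| (κ + 1) c ha₁ hc m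
  refine ⟨N₁ + ⌈r₀ ^ 4⌉₊, ?_⟩
  intro s K M p Φ β σ hKM hN hs₁ hs₂ hp hB h hβ hβ₀ halt
  push_cast at hN
  obtain ⟨hs, hm⟩ := hbounds s K M p Φ β σ hKM
    (by linarith [Nat.cast_nonneg (α := ℝ) ⌈r₀ ^ 4⌉₊]) hs₁ hs₂ hp hB h hβ hβ₀ halt
  have hsm : s ∈ Icc 2 s := by rw [mem_Icc]; omega
  have hR0 : 0 < R' := hμ.trans_le ((hm s hsm).1.trans (hm s hsm).2)
  rw [abs_of_pos hR0] at hQ hΓ hthr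
  have hB0 : 0 ≤ B := (tailPrice_nonneg hp le_rfl).trans (hB 1 (by rw [mem_Icc]; omega))
  rw [abs_of_nonneg (mul_nonneg (hβ.trans hβ₀) hB0)] at hΓ
  have hNr : r₀ ^ 4 ≤ (M : ℝ) - K := by
    linarith [Nat.le_ceil (r₀ ^ 4), Nat.cast_nonneg (α := ℝ) N₁]
  have hN0 : 0 < (M : ℝ) - K := lt_of_lt_of_le (by positivity) hNr
  obtain ⟨r, hr, hrN⟩ : ∃ r, r = ((M : ℝ) - K) ^ (1 / 4 : ℝ) ∧ r ^ 4 = (M : ℝ) - K := by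
    refine ⟨_, rfl, ?_⟩
    rw [← Real.rpow_natCast, ← Real.rpow_mul hN0.le]
    norm_num
  have hr3 : ((M : ℝ) - K) ^ (3 / 4 : ℝ) = r ^ 3 := by
    rw [hr, ← Real.rpow_natCast, ← Real.rpow_mul hN0.le]
    norm_num
  have hr0 : 0 < r := by rw [hr]; positivity
  have hrr : r₀ ≤ r := by
    rw [← hrN] at hNr
    exact le_of_pow_le_pow_left₀ four_ne_zero hr0.le hNr
  obtain ⟨hrR, hrκ, hrc⟩ := hthr r hrr
  have hr1 : 1 ≤ r := hr₀.trans hrr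
  have hr2 : 1 ≤ r ^ 2 := one_le_pow₀ hr1
  have hsa : (s : ℝ) ≤ |a₂| * r ^ 4 := by
    rw [hrN]; exact hs₂.trans (mul_le_mul_of_nonneg_right (le_abs_self _) hN0.le)
  obtain ⟨L, hL⟩ : ∃ L, L = ⌈κ * r ^ 2⌉₊ := ⟨_, rfl⟩
  have hκpos : 0 < κ := by rw [hκ]; positivity
  have hL1 : 1 ≤ L := by
    rw [hL, Nat.one_le_ceil_iff]; positivity
  have hLle : (L : ℝ) ≤ (κ + 1) * r ^ 2 := by
    have := Nat.ceil_lt_add_one (show 0 ≤ κ * r ^ 2 by positivity)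
    rw [← hL] at this
    linarith
  have hLge : κ * r ^ 2 ≤ L := by rw [hL]; exact Nat.le_ceil _
  have hLs : L + 1 < s := by
    have : (L : ℝ) + 1 < s := by
      rw [← hrN] at hs₁
      linarith
    exact_mod_cast this
  have hlow := half_le_ncard_allocations (u := 1 / r ^ 2) hKM.le hp hB h hβ hβ₀ hμ
    (fun j hj => (hm j hj).1) (fun j hj => (hm j hj).2) hL1 hLs (by positivity)
    (by rw [div_le_one (by positivity)]; exact hr2)
    (by
      rw [mul_one_div, div_le_one (by positivity)]
      exact hrR.trans (le_self_pow₀ hr1 two_ne_zero))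
    (by
      rw [← hQ]
      have h1 : Q * |a₂| + 3 ≤ 1 / r ^ 2 * (μ * L) := by
        rw [one_div_mul_eq_div, le_div_iff₀ (by positivity)]
        calc (Q * |a₂| + 3) * r ^ 2 = μ * (κ * r ^ 2) := by rw [hκ]; field_simp
          _ ≤ μ * L := mul_le_mul_of_nonneg_left hLge hμ.le
      have h2 : Q * (1 / r ^ 2) ^ 2 * s ≤ Q * |a₂| := by
        calc Q * (1 / r ^ 2) ^ 2 * s ≤ Q * (1 / r ^ 2) ^ 2 * (|a₂| * r ^ 4) := by gcongr
          _ = Q * |a₂| := by field_simp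
      have h3 : Real.exp (-3) ≤ 1 / 16 := by
        rw [Real.exp_neg, ← one_div]
        refine one_div_le_one_div_of_le (by norm_num) ?_
        have h4 := Real.exp_one_gt_d9
        have h5 : Real.exp 3 = Real.exp 1 ^ 3 := by rw [← Real.exp_nat_mul]; norm_num
        rw [h5]
        calc (16 : ℝ) ≤ 2.7 ^ 3 := by norm_num
          _ ≤ _ := pow_le_pow_left₀ (by norm_num) (by linarith) 3
      exact (Real.exp_le_exp.2 (by linarith)).trans h3)
  have hupp := ncard_diff_cluster_mul_le (A := Q * |a₂| + Γ * (κ + 1) + 1) (δ := δ) (u := 1 / r)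
    hs h hβ (fun j hj => (hm j hj).2) (by positivity)
    (by rw [div_le_one hr0]; exact hr1)
    (by rw [mul_one_div, div_le_one hr0]; exact hrR)
  rw [← hQ, hr3] at hupp
  have hΓe : 2 * β₀ * B * R' + 2 * R' + 3 * R' / μ = Γ := by rw [hΓ]; ring
  rw [hΓe] at hlow
  set V := (∏ j ∈ Icc 2 s, (1 - Real.exp (-(β * tailPrice s p j - σ)))) *
        Real.exp (σ * ((M : ℝ) - K) - β * (Φ - K * ∑ i ∈ Icc 1 s, p i)) with hV
  have hV0 : 0 < V := by
    refine mul_pos (prod_pos fun j hj => ?_) (Real.exp_pos _)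
    exact (Real.exp_pos _).trans_le (exp_neg_le_one_sub_exp_neg (h.pos j hj) le_rfl)
  set a := ((allocations s K M p Φ).ncard : ℝ) with ha
  set bad := ((allocations s K M p Φ \
    cluster s K M p Φ β σ δ (Q * |a₂| + Γ * (κ + 1) + 1)).ncard : ℝ) with hbad
  have ha0 : 0 < a := by
    by_contra hcon
    have h0 : a = 0 := le_antisymm (not_lt.1 hcon) (Nat.cast_nonneg _)
    rw [h0] at hlow
    norm_num at hlow
  have hlow' : 1 ≤ 2 * a * V * Real.exp (Γ * (κ + 1) * r ^ 2) := by
    have h1 : Real.exp (Γ * L) ≤ Real.exp (Γ * (κ + 1) * r ^ 2) := by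
      apply Real.exp_le_exp.2
      rw [mul_assoc]
      exact mul_le_mul_of_nonneg_left hLle hΓ0
    have h2 := mul_le_mul_of_nonneg_left h1 (mul_nonneg ha0.le hV0.le)
    linarith
  have hupp' : bad * V
      ≤ 2 * (|a₂| * r ^ 4) * (Real.exp (-(Γ * (κ + 1) * r ^ 2)) * Real.exp (-r ^ 2)) := by
    refine hupp.trans ?_
    have h1 : -(1 / r * ((Q * |a₂| + Γ * (κ + 1) + 1) * r ^ 3)) + Q * (1 / r) ^ 2 * s
        ≤ -(Γ * (κ + 1) * r ^ 2) + -r ^ 2 := by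
      have h2 : Q * (1 / r) ^ 2 * s ≤ Q * |a₂| * r ^ 2 := by
        calc Q * (1 / r) ^ 2 * s ≤ Q * (1 / r) ^ 2 * (|a₂| * r ^ 4) := by gcongr
          _ = Q * |a₂| * r ^ 2 := by field_simp
      have h3 : 1 / r * ((Q * |a₂| + Γ * (κ + 1) + 1) * r ^ 3)
          = (Q * |a₂| + Γ * (κ + 1) + 1) * r ^ 2 := by field_simp
      rw [h3]
      linarith
    rw [← Real.exp_add]
    calc (s : ℝ) * (2 * _) ≤ (|a₂| * r ^ 4) * (2 * Real.exp (-(Γ * (κ + 1) * r ^ 2) + -r ^ 2)) :=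
          mul_le_mul hsa (mul_le_mul_of_nonneg_left (Real.exp_le_exp.2 h1) two_pos.le)
            (by positivity) (by positivity)
      _ = _ := by ring
  have hfin : bad * V ≤ (4 * |a₂| * r ^ 4 * Real.exp (-r ^ 2) * a) * V := by
    have h1 := mul_le_mul_of_nonneg_left hlow'
      (show 0 ≤ 2 * (|a₂| * r ^ 4) * (Real.exp (-(Γ * (κ + 1) * r ^ 2)) * Real.exp (-r ^ 2)) by
        positivity)
    rw [mul_one] at h1
    refine (hupp'.trans h1).trans_eq ?_
    have h2 : Real.exp (-(Γ * (κ + 1) * r ^ 2)) * Real.exp (Γ * (κ + 1) * r ^ 2) = 1 := by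
      rw [← Real.exp_add, neg_add_cancel, Real.exp_zero]
    linear_combination (4 * |a₂| * r ^ 4 * Real.exp (-r ^ 2) * a * V) * h2
  refine (le_of_mul_le_mul_right hfin hV0).trans_lt ?_
  rw [← hrN]
  exact mul_lt_mul_of_pos_right hrc ha0

/-! ### Existence and uniqueness of the parameters -/

theorem geomMean_lt_geomMean {x y : ℝ} (hx : 0 < x) (hxy : x < y) : geomMean y < geomMean x :=
  one_div_lt_one_div_of_lt (sub_pos.2 (Real.one_lt_exp_iff.2 hx))
    (sub_lt_sub_right (Real.exp_lt_exp.2 hxy) _)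

theorem geomMean_le_geomMean {x y : ℝ} (hx : 0 < x) (hxy : x ≤ y) : geomMean y ≤ geomMean x :=
  one_div_le_one_div_of_le (sub_pos.2 (Real.one_lt_exp_iff.2 hx))
    (sub_le_sub_right (Real.exp_le_exp.2 hxy) _)

theorem geomMean_log_one_add {y : ℝ} (hy : 0 < y) : geomMean (Real.log (1 + 1 / y)) = y := by
  rw [geomMean, Real.exp_log (by positivity)]
  simp

theorem continuousAt_geomMean {x : ℝ} (hx : 0 < x) : ContinuousAt geomMean x := by
  unfold geomMean
  refine ContinuousAt.div continuousAt_const (by fun_prop) ?_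
  exact (sub_pos.2 (Real.one_lt_exp_iff.2 hx)).ne'

theorem mul_geomMean_le {b h w : ℝ} (hb : 0 < b) (hh : 0 ≤ h) (hw : 0 < w) :
    h * geomMean (b * h + w) ≤ 1 / b := by
  have h1 : 0 < b * h + w := by positivity
  have h2 : b * h + w ≤ Real.exp (b * h + w) - 1 := by linarith [Real.add_one_le_exp (b * h + w)]
  rw [geomMean, mul_one_div, div_le_div_iff₀ (by linarith) hb]
  linarith

section Existence

variable {J : Finset ℕ} {h : ℕ → ℝ} {N : ℝ}

theorem exists_sum_geomMean_eq (hh : ∀ j ∈ J, 0 ≤ h j) {i : ℕ} (hi : i ∈ J) (hi0 : h i = 0)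
    (hN : 0 < N) {β : ℝ} (hβ : 0 ≤ β) :
    ∃ w, 0 < w ∧ ∑ j ∈ J, geomMean (β * h j + w) = N := by
  -- At `w₀` the level h_i = 0 alone contributes N; at `w₁` no level contributes more than N/#J.
  have hJ : 0 < (#J : ℝ) := by exact_mod_cast card_pos.2 ⟨i, hi⟩
  have hJ1 : (1 : ℝ) ≤ #J := by exact_mod_cast card_pos.2 ⟨i, hi⟩
  set w₀ := Real.log (1 + 1 / N) with hw₀
  set w₁ := Real.log (1 + 1 / (N / #J)) with hw₁
  have hw₀0 : 0 < w₀ := Real.log_pos (by linarith [one_div_pos.2 hN])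
  have hle : w₀ ≤ w₁ := by
    refine Real.log_le_log (by positivity) ?_
    have : 1 / N ≤ 1 / (N / #J) :=
      one_div_le_one_div_of_le (by positivity) (div_le_self hN.le hJ1)
    linarith
  have hpos : ∀ j ∈ J, ∀ w, 0 < w → 0 < β * h j + w := fun j hj w hw => by
    have := mul_nonneg hβ (hh j hj)
    linarith
  have hcont : ContinuousOn (fun w => ∑ j ∈ J, geomMean (β * h j + w)) (Set.Icc w₀ w₁) := by
    intro w hw
    refine ContinuousAt.continuousWithinAt ?_
    refine tendsto_finsetSum _ fun j hj => ?_
    exact ContinuousAt.comp' (f := fun w => β * h j + w)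
      (continuousAt_geomMean (hpos j hj w (hw₀0.trans_le hw.1))) (by fun_prop)
  have hmem : N ∈ Set.Icc (∑ j ∈ J, geomMean (β * h j + w₁))
      (∑ j ∈ J, geomMean (β * h j + w₀)) := by
    constructor
    · calc ∑ j ∈ J, geomMean (β * h j + w₁) ≤ ∑ _j ∈ J, N / #J := by
            refine sum_le_sum fun j hj => ?_
            rw [← geomMean_log_one_add (y := N / #J) (by positivity), ← hw₁]
            refine geomMean_le_geomMean (hw₀0.trans_le hle) ?_
            have := mul_nonneg hβ (hh j hj)
            linarith
        _ = N := by rw [sum_const, nsmul_eq_mul]; field_simp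
    · calc N = geomMean (β * h i + w₀) := by
            rw [hi0, mul_zero, zero_add, hw₀, geomMean_log_one_add hN]
        _ ≤ _ := single_le_sum (f := fun j => geomMean (β * h j + w₀))
            (fun j hj => (geomMean_pos (hpos j hj w₀ hw₀0)).le) hi
  obtain ⟨w, hw, hwN⟩ := intermediate_value_Icc' hle hcont hmem
  exact ⟨w, hw₀0.trans_le hw.1, hwN⟩

/-- The two conditions of the Bose type have a solution with `β ≥ 0`. -/
theorem exists_sum_mul_geomMean_eq (hh : ∀ j ∈ J, 0 ≤ h j) {i : ℕ} (hi : i ∈ J) (hi0 : h i = 0)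
    (hN : 0 < N) {e : ℝ} (he : 0 < e) (heN : #J * e ≤ N * ∑ j ∈ J, h j) :
    ∃ β w, 0 ≤ β ∧ 0 < w ∧ ∑ j ∈ J, geomMean (β * h j + w) = N ∧
      ∑ j ∈ J, h j * geomMean (β * h j + w) = e := by
  have hJ : 0 < (#J : ℝ) := by exact_mod_cast card_pos.2 ⟨i, hi⟩
  have hex : ∀ β, ∃ w, 0 ≤ β → 0 < w ∧ ∑ j ∈ J, geomMean (β * h j + w) = N := fun β => by
    by_cases hβ : 0 ≤ β
    · obtain ⟨w, hw⟩ := exists_sum_geomMean_eq hh hi hi0 hN hβ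
      exact ⟨w, fun _ => hw⟩
    · exact ⟨0, fun h0 => absurd h0 hβ⟩
  choose W hW using hex
  have hpos : ∀ β, 0 ≤ β → ∀ j ∈ J, ∀ w, 0 < w → 0 < β * h j + w := fun β hβ j hj w hw => by
    have := mul_nonneg hβ (hh j hj)
    linarith
  have hanti : ∀ β, 0 ≤ β → ∀ v w, 0 < v → v < w →
      ∑ j ∈ J, geomMean (β * h j + w) < ∑ j ∈ J, geomMean (β * h j + v) :=
    fun β hβ v w hv hvw => sum_lt_sum_of_nonempty ⟨i, hi⟩ fun j hj =>
      geomMean_lt_geomMean (hpos β hβ j hj v hv) (by linarith)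
  have hcβ : ∀ β, 0 ≤ β → ∀ w, 0 < w →
      ContinuousAt (fun β => ∑ j ∈ J, geomMean (β * h j + w)) β := fun β hβ w hw => by
    refine tendsto_finsetSum _ fun j hj => ?_
    exact ContinuousAt.comp' (f := fun β => β * h j + w)
      (continuousAt_geomMean (hpos β hβ j hj w hw)) (by fun_prop)
  -- The total is strictly decreasing in w, so strict inequalities at a fixed w near `W β`, which
  -- persist for nearby β, trap W.
  have hWc : ContinuousOn W (Set.Ici 0) := by
    intro β hβ
    obtain ⟨hw, hwN⟩ := hW β hβ
    refine tendsto_order.2 ⟨fun a ha => ?_, fun a ha => ?_⟩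
    · set v := max a (W β / 2) with hv
      have hv0 : 0 < v := lt_max_of_lt_right (by linarith)
      have hvW : v < W β := max_lt ha (by linarith)
      have h1 := hanti β hβ v (W β) hv0 hvW
      rw [hwN] at h1
      filter_upwards [(hcβ β hβ v hv0).continuousWithinAt.eventually (lt_mem_nhds h1),
        self_mem_nhdsWithin] with γ hγ hγ0
      obtain ⟨hwγ, hwγN⟩ := hW γ hγ0
      by_contra hcon
      have h2 : W γ ≤ v := (not_lt.1 hcon).trans (le_max_left _ _)
      rcases h2.lt_or_eq with h3 | h3
      · have := hanti γ hγ0 (W γ) v hwγ h3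
        linarith
      · rw [h3] at hwγN
        linarith
    · have ha0 : 0 < a := hw.trans ha
      have h1 := hanti β hβ (W β) a hw ha
      rw [hwN] at h1
      filter_upwards [(hcβ β hβ a ha0).continuousWithinAt.eventually (gt_mem_nhds h1),
        self_mem_nhdsWithin] with γ hγ hγ0
      obtain ⟨hwγ, hwγN⟩ := hW γ hγ0
      by_contra hcon
      rcases (not_lt.1 hcon).lt_or_eq with h3 | h3
      · have := hanti γ hγ0 a (W γ) ha0 h3
        linarith
      · rw [← h3] at hwγN
        linarith
  have hHc : ContinuousOn (fun β => ∑ j ∈ J, h j * geomMean (β * h j + W β)) (Set.Ici 0) := by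
    intro β hβ
    refine tendsto_finsetSum _ fun j hj => Filter.Tendsto.const_mul _ ?_
    refine ContinuousAt.comp_continuousWithinAt (f := fun β => β * h j + W β)
      (continuousAt_geomMean (hpos β hβ j hj _ (hW β hβ).1)) ?_
    exact (continuousWithinAt_id.mul continuousWithinAt_const).add (hWc β hβ)
  -- At this β each level has energy at most 1/β, so the total is at most e; at β = 0 all means are
  -- equal to N/#J and the energy is at least e.
  have hb : 0 < #J / e := by positivity
  have hmem : e ∈ Set.Icc (∑ j ∈ J, h j * geomMean (#J / e * h j + W (#J / e)))
      (∑ j ∈ J, h j * geomMean (0 * h j + W 0)) := by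
    constructor
    · calc ∑ j ∈ J, h j * geomMean (#J / e * h j + W (#J / e)) ≤ ∑ _j ∈ J, 1 / (#J / e) :=
            sum_le_sum fun j hj => mul_geomMean_le hb (hh j hj) (hW _ hb.le).1
        _ = e := by rw [sum_const, nsmul_eq_mul]; field_simp
    · have h0 := (hW 0 le_rfl).2
      simp only [zero_mul, zero_add, sum_const, nsmul_eq_mul] at h0 ⊢
      rw [← sum_mul]
      refine le_of_mul_le_mul_left ?_ hJ
      calc #J * e ≤ N * ∑ j ∈ J, h j := heN
        _ = _ := by rw [← h0]; ring
  obtain ⟨β, hβ, hβe⟩ := intermediate_value_Icc' hb.le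
    (hHc.mono fun γ hγ => hγ.1) hmem
  exact ⟨β, W β, hβ.1, (hW β hβ.1).1, (hW β hβ.1).2, hβe⟩

end Existence

/-- Strict monotonicity of `geomMean` separates exponents. -/
theorem eq_of_sum_mul_sub_geomMean {J : Finset ℕ} {x y : ℕ → ℝ} (hx : ∀ j ∈ J, 0 < x j)
    (hy : ∀ j ∈ J, 0 < y j)
    (h : ∑ j ∈ J, (x j - y j) * (geomMean (x j) - geomMean (y j)) = 0) :
    ∀ j ∈ J, x j = y j := by
  have hle : ∀ j ∈ J, (x j - y j) * (geomMean (x j) - geomMean (y j)) ≤ 0 := fun j hj => by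
    rcases le_total (x j) (y j) with h1 | h1
    · exact mul_nonpos_of_nonpos_of_nonneg (sub_nonpos.2 h1)
        (sub_nonneg.2 (geomMean_le_geomMean (hx j hj) h1))
    · exact mul_nonpos_of_nonneg_of_nonpos (sub_nonneg.2 h1)
        (sub_nonpos.2 (geomMean_le_geomMean (hy j hj) h1))
  intro j hj
  have h0 := (sum_eq_zero_iff_of_nonpos hle).1 h j hj
  rcases mul_eq_zero.1 h0 with h1 | h1
  · linarith
  · rcases lt_trichotomy (x j) (y j) with h2 | h2 | h2
    · linarith [geomMean_lt_geomMean (hx j hj) h2]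
    · exact h2
    · linarith [geomMean_lt_geomMean (hy j hj) h2]

section Parameters

variable {s K M : ℕ} {p : ℕ → ℝ} {Φ : ℝ}

/-- Subtracting the two systems gives Σ (x_j - x'_j)(m(x_j) - m(x'_j)) = 0 with m = `geomMean`
decreasing, so x_j = x'_j for all j; two distinct levels then determine β and σ. -/
theorem IsParameters.unique {β σ β' σ' : ℝ} (h : IsParameters s K M p Φ β σ)
    (h' : IsParameters s K M p Φ β' σ') (hs : 2 ≤ s)
    (hne : ∃ j ∈ Icc 2 s, tailPrice s p j ≠ tailPrice s p s) : β = β' ∧ σ = σ' := by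
  have hsm : s ∈ Icc 2 s := by rw [mem_Icc]; omega
  have hzero : ∑ j ∈ Icc 2 s, ((β * tailPrice s p j - σ) - (β' * tailPrice s p j - σ')) *
      (geomMean (β * tailPrice s p j - σ) - geomMean (β' * tailPrice s p j - σ')) = 0 := by
    calc _ = (β - β') * (∑ j ∈ Icc 2 s, tailPrice s p j * meanIncrement s p β σ j
            - ∑ j ∈ Icc 2 s, tailPrice s p j * meanIncrement s p β' σ' j)
          - (σ - σ') * (∑ j ∈ Icc 2 s, meanIncrement s p β σ j
            - ∑ j ∈ Icc 2 s, meanIncrement s p β' σ' j) := by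
          rw [← sum_sub_distrib, ← sum_sub_distrib, mul_sum, mul_sum, ← sum_sub_distrib]
          refine sum_congr rfl fun j _ => ?_
          simp only [meanIncrement, geomMean]
          ring
      _ = 0 := by rw [h.budget_tailPrice, h'.budget_tailPrice, h.total, h'.total]; ring
  have heq := eq_of_sum_mul_sub_geomMean h.pos h'.pos hzero
  obtain ⟨j, hj, hjs⟩ := hne
  have h1 := heq j hj
  have h2 := heq s hsm
  have h3 : (β - β') * (tailPrice s p j - tailPrice s p s) = 0 := by linarith
  have h4 : β = β' := sub_eq_zero.1 ((mul_eq_zero.1 h3).resolve_right (sub_ne_zero.2 hjs))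
  refine ⟨h4, ?_⟩
  rw [h4] at h2
  linarith

theorem exists_isParameters (hs : 2 ≤ s) (hKM : K < M) (hp : ∀ i ∈ Icc 1 s, 0 ≤ p i)
    (hlow : ((M : ℝ) - K) * tailPrice s p s < Φ - K * ∑ i ∈ Icc 1 s, p i)
    (hupp : ((s : ℝ) - 1) * (Φ - K * ∑ i ∈ Icc 1 s, p i)
        ≤ ((M : ℝ) - K) * ∑ j ∈ Icc 2 s, tailPrice s p j) :
    ∃ β σ, 0 ≤ β ∧ IsParameters s K M p Φ β σ := by
  have hN : 0 < (M : ℝ) - K := by rw [sub_pos]; exact_mod_cast hKM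
  have hsm : s ∈ Icc 2 s := by rw [mem_Icc]; omega
  have hcard : ((#(Icc 2 s) : ℕ) : ℝ) = s - 1 := by
    rw [Nat.card_Icc, Nat.cast_sub (by omega)]; push_cast; ring
  obtain ⟨β, w, hβ, hw, h1, h2⟩ := exists_sum_mul_geomMean_eq (J := Icc 2 s)
    (h := fun j => tailPrice s p j - tailPrice s p s) (N := (M : ℝ) - K)
    (e := Φ - K * ∑ i ∈ Icc 1 s, p i - ((M : ℝ) - K) * tailPrice s p s)
    (fun j hj => sub_nonneg.2 (tailPrice_le hp (by rw [mem_Icc] at hj; omega) (mem_Icc.1 hj).2))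
    hsm (sub_self _) hN (by linarith)
    (by rw [sum_sub_distrib, sum_const, nsmul_eq_mul, hcard]; linarith)
  have hx : ∀ j, β * (tailPrice s p j - tailPrice s p s) + w
      = β * tailPrice s p j - (β * tailPrice s p s - w) := fun j => by ring
  simp only [hx] at h1 h2
  refine ⟨β, β * tailPrice s p s - w, hβ, fun j hj => ?_, h1, ?_⟩
  · rw [← hx]
    have : 0 ≤ β * (tailPrice s p j - tailPrice s p s) := mul_nonneg hβ
      (sub_nonneg.2 (tailPrice_le hp (by rw [mem_Icc] at hj; omega) (mem_Icc.1 hj).2))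
    linarith
  · rw [sum_Icc_two_mul_sum_eq]
    simp only [sub_mul, sum_sub_distrib, ← mul_sum, h1] at h2
    change ∑ j ∈ Icc 2 s, tailPrice s p j * geomMean _ = _
    linarith

theorem existsUnique_isParameters (hs : 2 ≤ s) (hKM : K ≤ M) (hp : ∀ i ∈ Icc 1 s, 0 ≤ p i)
    (hlow : ((M : ℝ) - K) * tailPrice s p s < Φ - K * ∑ i ∈ Icc 1 s, p i)
    (hupp : ((s : ℝ) - 1) * (Φ - K * ∑ i ∈ Icc 1 s, p i)
        ≤ ((M : ℝ) - K) * ∑ j ∈ Icc 2 s, tailPrice s p j) :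
    (∃! x : ℝ × ℝ, IsParameters s K M p Φ x.1 x.2) ∧
      ∀ β σ : ℝ, IsParameters s K M p Φ β σ → 0 ≤ β := by
  have hs1 : (0 : ℝ) < s - 1 := by
    have : (2 : ℝ) ≤ s := by exact_mod_cast hs
    linarith
  have hcard : ((#(Icc 2 s) : ℕ) : ℝ) = s - 1 := by
    rw [Nat.card_Icc, Nat.cast_sub (by omega)]; push_cast; ring
  have hlt := mul_lt_mul_of_pos_left hlow hs1
  have hKM' : K < M := by
    refine lt_of_le_of_ne hKM fun hKM0 => ?_
    rw [hKM0] at hlt hupp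
    simp only [sub_self, zero_mul, mul_zero] at hlt hupp
    linarith
  -- If all levels were equal, the strict lower bound on the budget would contradict the upper one.
  have hne : ∃ j ∈ Icc 2 s, tailPrice s p j ≠ tailPrice s p s := by
    by_contra hcon
    push Not at hcon
    rw [sum_congr rfl hcon, sum_const, nsmul_eq_mul, hcard] at hupp
    linarith
  obtain ⟨β, σ, hβ, h⟩ := exists_isParameters hs hKM' hp hlow hupp
  refine ⟨⟨(β, σ), h, fun y hy => ?_⟩, fun β' σ' h' => ?_⟩
  · obtain ⟨h1, h2⟩ := IsParameters.unique hy h hs hne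
    exact Prod.ext h1 h2
  · rw [(h'.unique h hs hne).1]; exact hβ

end Parameters

theorem mainTheorem1 :
    -- `β` and `σ` are determined by the two conditions
    (∀ (s K M : ℕ) (p : ℕ → ℝ) (Φ : ℝ), 2 ≤ s → K ≤ M → (∀ i ∈ Finset.Icc 1 s, 0 ≤ p i) →
      ((M : ℝ) - K) * tailPrice s p s < Φ - K * ∑ i ∈ Finset.Icc 1 s, p i →
      ((s : ℝ) - 1) * (Φ - K * ∑ i ∈ Finset.Icc 1 s, p i)
        ≤ ((M : ℝ) - K) * ∑ j ∈ Finset.Icc 2 s, tailPrice s p j →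
      (∃! x : ℝ × ℝ, IsParameters s K M p Φ x.1 x.2) ∧
        ∀ β σ : ℝ, IsParameters s K M p Φ β σ → 0 ≤ β) ∧
    -- the allocations given by the formula form an overwhelming majority
    (∀ a₁ a₂ B β₀ R δ : ℝ, 0 < a₁ → 0 < δ →
      ∃ A : ℝ, 0 < A ∧ ∀ (m : ℕ) (c : ℝ), 0 < c → ∃ N₀ : ℕ,
        ∀ (s K M : ℕ) (p : ℕ → ℝ) (Φ β σ : ℝ),
          K < M → (N₀ : ℝ) ≤ (M : ℝ) - K →
          a₁ * ((M : ℝ) - K) ≤ s → (s : ℝ) ≤ a₂ * ((M : ℝ) - K) →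
          (∀ i ∈ Finset.Icc 1 s, 0 ≤ p i) →
          (∀ i ∈ Finset.Icc 1 s, tailPrice s p i ≤ B) →
          IsParameters s K M p Φ β σ → 0 ≤ β → β ≤ β₀ →
          (Real.exp (β₀ * B) < 1 + a₁ ∨
            ∀ j ∈ Finset.Icc 2 s, meanIncrement s p β σ j ≤ R) →
          ((allocations s K M p Φ \ cluster s K M p Φ β σ δ A).ncard : ℝ)
            < c / ((M : ℝ) - K) ^ m * ((allocations s K M p Φ).ncard : ℝ)) := by
  exact ⟨fun s K M p Φ hs hKM hp hlow hupp => existsUnique_isParameters hs hKM hp hlow hupp,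
    fun a₁ a₂ B β₀ R δ ha₁ _ => exists_cluster_constant a₁ a₂ B β₀ R δ ha₁⟩
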